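/- Let $G$ be a finite simple graph with linearly ordered vertex set $V(G)$ and edge set $E(G)$. Let $\mathcal L(G)$ be the 2-step nilpotent real Lie algebra with basis $x_i$ ($i\in V(G)$) and $x_{i,j}$ ($\{i,j\}\in E(G)$, $i<j$), in which $[x_i,x_j]=x_{i,j}$ for $\{i,j\}\in E(G)$, $i<j$, and all other brackets of basis vectors, up to skew symmetry, vanish. Its Chevalley–Eilenberg complex $\mathcal C^\bullet(G)$ is the exterior algebra of $\mathcal L(G)^*$ with the odd derivation $Q$ such that $Q(x_i^*)=0$ and $Q(x_{i,j}^*)=x_i^*x_j^*$. Put $b_k(G)=\dim H^k(\mathcal C^\bullet(G))$. The essential subcomplex $\mathcal C^\bullet(G,V(G))$ is spanned by the monomials $x_{i_1}^*\cdots x_{i_p}^*x_{r_1,s_1}^*\cdots x_{r_q,s_q}^*$ with $\{i_1,\dots,i_p,r_1,s_1,\dots,r_q,s_q\}=V(G)$ (and it is $0$ if $V(G)=\emptyset$); put $\beta_k(G)=\dim H^k(\mathcal C^\bullet(G,V(G)))$. For a graph $H$, let $\left|\binom{G}{H}\right|$ be the number of subsets $S\subseteq V(G)$ such that the induced subgraph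 $G[S]$ is isomorphic to $H$. Let $G_1,\dots,G_{23}$ be the following graphs, where $n$ is the number of vertices, the vertices are $0,\dots,n-1$, and $ab$ denotes the edge $\{a,b\}$. - $n=2$: $G_1$: $01$. - $n=3$: $G_2$: no edges; $G_3$: $01$; $G_4$: $01,12$; $G_5$: $01,12,02$. - $n=4$: $G_6$: $01,12$; $G_7$: $01,12,23$; $G_8$: $01,12,23,03$; $G_9$: $01,12,02$; $G_{10}$: $01,12,13$; $G_{11}$: $01,12,23,02$; $G_{12}$: $01,12,23,03,02$; $G_{13}=K_4$. - $n=5$: $G_{14}$: $34,04,01,12,24,13$; $G_{15}$: $34,04,01,12,24,14,13$; and, with $C=\{34,04,01,12,23\}$ the edge set of a 5-cycle, $G_{16}$: $C$; $G_{17}$: $C,24$; $G_{18}$: $C,24,14$; $G_{19}$: $C,24,13$; $G_{20}$: $C,24,14,13$; $G_{21}$: $C,24,14,03$; $G_{22}$: $C,24,14,03,13$; $G_{23}=K_5$. Then: 1. For every finite simple graph $G$, $$b_3(G)=\sum_{j=1}^{23}\beta_3(G_j)\left|\binom{G}{G_j}\right|.$$ 2. The values $\beta_3(G_1),\dots,\beta_3(G_{23})$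 are, in this order, $1,1,2,4,9,1,1,5,2,2,3,8,14,1,1,1,1,1,2,2,3,4,6$. 3. The graphs $G_1,\dots,G_{23}$ are pairwise non-isomorphic, and a finite simple graph $H$ satisfies $\beta_3(H)\neq 0$ if and only if $H$ is isomorphic to one of them. -/

import Mathlib

namespace DaniMainkar

/-! ## The 2-step nilpotent Lie algebra of a graph -/

section LieAlgebra

variable {V : Type*} [LinearOrder V]

/-- The edges `{i, j}` of `G`, each recorded once as the pair `(i, j)` with `i < j`. -/
@[ext]
structure Edge (G : SimpleGraph V) where
  /-- The smaller endpoint. -/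
  src : V
  /-- The larger endpoint. -/
  tgt : V
  lt : src < tgt
  adj : G.Adj src tgt

instance {G : SimpleGraph V} [Finite V] : Finite (Edge G) :=
  Finite.of_injective (fun e : Edge G => (e.src, e.tgt)) fun e f h => by
    simp only [Prod.mk.injEq] at h
    exact Edge.ext h.1 h.2

noncomputable instance {G : SimpleGraph V} [Finite V] : Fintype (Edge G) :=
  Fintype.ofFinite _

noncomputable instance {G : SimpleGraph V} : DecidableEq (Edge G) :=
  Classical.decEq _

/-- The real vector space with basis `x_i` (`i` a vertex of `G`) and `x_{i,j}`
(`{i, j}` an edge of `G`, `i < j`): an element is given by its coordinates and stands for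
`∑ i, vert i • x_i + ∑ e, edge e • x_e`. -/
@[ext]
structure LieAlg (G : SimpleGraph V) where
  /-- The coordinates at the vectors `x_i`. -/
  vert : V → ℝ
  /-- The coordinates at the vectors `x_{i,j}`. -/
  edge : Edge G → ℝ

/-- Vectors as pairs of coordinate families; the vector space structure is transported along this
bijection, so that it is the coordinatewise one. -/
def LieAlg.equivProd (G : SimpleGraph V) : LieAlg G ≃ (V → ℝ) × (Edge G → ℝ) where
  toFun a := (a.vert, a.edge)
  invFun p := ⟨p.1, p.2⟩

noncomputable instance (G : SimpleGraph V) : AddCommGroup (LieAlg G) :=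
  (LieAlg.equivProd G).addCommGroup

noncomputable instance (G : SimpleGraph V) : Module ℝ (LieAlg G) :=
  (LieAlg.equivProd G).module ℝ

/-- The bracket with `[x_i, x_j] = x_{i,j}` for every edge `{i, j}` with `i < j`, and all
other brackets of basis vectors, up to skew symmetry, equal to zero. -/
noncomputable instance (G : SimpleGraph V) : Bracket (LieAlg G) (LieAlg G) where
  bracket a b := ⟨0, fun e => a.vert e.src * b.vert e.tgt - a.vert e.tgt * b.vert e.src⟩

section Coordinates

variable {G : SimpleGraph V} (a b : LieAlg G) (c : ℝ) (i : V) (e : Edge G)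

@[simp] theorem bracket_vert : ⁅a, b⁆.vert i = 0 := rfl

@[simp] theorem bracket_edge :
    ⁅a, b⁆.edge e = a.vert e.src * b.vert e.tgt - a.vert e.tgt * b.vert e.src := rfl

@[simp] theorem zero_vert : (0 : LieAlg G).vert i = 0 := rfl

@[simp] theorem zero_edge : (0 : LieAlg G).edge e = 0 := rfl

@[simp] theorem add_vert : (a + b).vert i = a.vert i + b.vert i := rfl

@[simp] theorem add_edge : (a + b).edge e = a.edge e + b.edge e := rfl

@[simp] theorem smul_vert : (c • a).vert i = c * a.vert i := rfl

@[simp] theorem smul_edge : (c • a).edge e = c * a.edge e := rfl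

end Coordinates

noncomputable instance (G : SimpleGraph V) : LieRing (LieAlg G) where
  add_lie a b c := by ext <;> simp; ring
  lie_add a b c := by ext <;> simp; ring
  lie_self a := by ext <;> simp; ring
  leibniz_lie a b c := by ext <;> simp

noncomputable instance (G : SimpleGraph V) : LieAlgebra ℝ (LieAlg G) where
  lie_smul c a b := by ext <;> simp; ring

/-- The basis vector `x_i` of a vertex `i`. -/
def vertexVec (G : SimpleGraph V) (i : V) : LieAlg G := ⟨Pi.single i 1, 0⟩

/-- The basis vector `x_e` of an edge `e`. -/
noncomputable def edgeVec (G : SimpleGraph V) (e : Edge G) : LieAlg G := ⟨0, Pi.single e 1⟩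

/-- The dual vector `x_i^*` of a vertex `i`. -/
def vertexDual (G : SimpleGraph V) (i : V) : Module.Dual ℝ (LieAlg G) where
  toFun a := a.vert i
  map_add' _ _ := rfl
  map_smul' _ _ := rfl

/-- The dual vector `x_e^*` of an edge `e`. -/
def edgeDual (G : SimpleGraph V) (e : Edge G) : Module.Dual ℝ (LieAlg G) where
  toFun a := a.edge e
  map_add' _ _ := rfl
  map_smul' _ _ := rfl

@[simp] theorem vertexDual_apply (G : SimpleGraph V) (i : V) (a : LieAlg G) :
    vertexDual G i a = a.vert i := rfl

@[simp] theorem edgeDual_apply (G : SimpleGraph V) (e : Edge G) (a : LieAlg G) :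
    edgeDual G e a = a.edge e := rfl

theorem lie_vertexVec {G : SimpleGraph V} (i j : V) (hij : i < j) (h : G.Adj i j) :
    ⁅vertexVec G i, vertexVec G j⁆ = edgeVec G ⟨i, j, hij, h⟩ := by
  ext e
  · rfl
  · rcases e with ⟨k, l, hkl, hadj⟩
    simp only [bracket_edge, vertexVec, edgeVec, Pi.single_apply, Edge.mk.injEq]
    by_cases hk : k = i
    · subst hk
      have h1 : ¬ l = k := hkl.ne'
      simp [h1]
    · by_cases hk' : k = j
      · subst hk'
        have h1 : ¬ l = i := fun h => absurd hij (by rw [← h]; exact hkl.not_gt)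
        simp [h1, hk]
      · simp [hk, hk']

theorem lie_vertexVec_of_not_adj {G : SimpleGraph V} (i j : V) (h : ¬ G.Adj i j) :
    ⁅vertexVec G i, vertexVec G j⁆ = 0 := by
  ext e
  · rfl
  · rcases e with ⟨k, l, hkl, hadj⟩
    simp only [bracket_edge, zero_edge, vertexVec, Pi.single_apply]
    by_cases hk : k = i
    · subst hk
      have h1 : ¬ l = j := fun h' => h (h' ▸ hadj)
      simp [h1, hkl.ne']
    · by_cases hk' : k = j
      · subst hk'
        have h1 : ¬ l = i := fun h' => h (h' ▸ hadj.symm)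
        simp [h1, hk]
      · simp [hk, hk']

theorem edgeVec_lie {G : SimpleGraph V} (e : Edge G) (a : LieAlg G) : ⁅edgeVec G e, a⁆ = 0 := by
  ext f
  · rfl
  · simp [edgeVec]

theorem lie_eq_sum {G : SimpleGraph V} [Finite V] (a b : LieAlg G) :
    ⁅a, b⁆ = ∑ e : Edge G,
      (a.vert e.src * b.vert e.tgt - a.vert e.tgt * b.vert e.src) • edgeVec G e := by
  ext f
  · rw [← vertexDual_apply, ← vertexDual_apply, map_sum]
    symm
    refine Finset.sum_eq_zero fun e _ => ?_
    simp [edgeVec]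
  · rw [← edgeDual_apply, ← edgeDual_apply, map_sum]
    simp [edgeVec, Pi.single_apply]

end LieAlgebra

/-! ## The Cartan-Chevalley-Eilenberg complex -/

section Complex

variable {V : Type*} [LinearOrder V] (G : SimpleGraph V)

/-- The exterior algebra of the dual of `LieAlg G`: skew-commuting real polynomials in the
variables `x_i^*` and `x_e^*`. -/
abbrev Cochains : Type _ := ExteriorAlgebra ℝ (Module.Dual ℝ (LieAlg G))

/-- The variable `x_i^*` of the vertex `i`. -/
noncomputable def xv (i : V) : Cochains G := ExteriorAlgebra.ι ℝ (vertexDual G i)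

/-- The variable `x_e^*` of the edge `e`. -/
noncomputable def xe (e : Edge G) : Cochains G := ExteriorAlgebra.ι ℝ (edgeDual G e)

theorem ι_mul_ι_swap (ξ η : Module.Dual ℝ (LieAlg G)) :
    ExteriorAlgebra.ι ℝ ξ * ExteriorAlgebra.ι ℝ η =
      -(ExteriorAlgebra.ι ℝ η * ExteriorAlgebra.ι ℝ ξ) :=
  eq_neg_of_add_eq_zero_left (ExteriorAlgebra.ι_add_mul_swap ξ η)

theorem ι_mul_ι_mul_ι (ξ η ζ : Module.Dual ℝ (LieAlg G)) :
    ExteriorAlgebra.ι ℝ ξ * (ExteriorAlgebra.ι ℝ η * ExteriorAlgebra.ι ℝ ζ) =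
      ExteriorAlgebra.ι ℝ η * ExteriorAlgebra.ι ℝ ζ * ExteriorAlgebra.ι ℝ ξ := by
  rw [← mul_assoc, ι_mul_ι_swap G ξ η, neg_mul, mul_assoc, ι_mul_ι_swap G ξ ζ, mul_neg, neg_neg,
    mul_assoc]

theorem contract_ι (d : Module.Dual ℝ (Module.Dual ℝ (LieAlg G))) (ξ : Module.Dual ℝ (LieAlg G)) :
    CliffordAlgebra.contractLeft (Q := 0) d (ExteriorAlgebra.ι ℝ ξ) =
      algebraMap ℝ (Cochains G) (d ξ) :=
  CliffordAlgebra.contractLeft_ι (Q := 0) d ξ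

theorem contract_ι_mul (d : Module.Dual ℝ (Module.Dual ℝ (LieAlg G)))
    (ξ : Module.Dual ℝ (LieAlg G)) (a : Cochains G) :
    CliffordAlgebra.contractLeft (Q := 0) d (ExteriorAlgebra.ι ℝ ξ * a) =
      d ξ • a - ExteriorAlgebra.ι ℝ ξ * CliffordAlgebra.contractLeft (Q := 0) d a :=
  CliffordAlgebra.contractLeft_ι_mul (Q := 0) d ξ a

variable [Finite V]

/-- The Chevalley-Eilenberg differential `Q = ∑_{e = {i,j}, i < j} x_i^* x_j^* ∂/∂x_e^*`, where
`∂/∂x_e^*` is the contraction with `x_e`. By `differential_one`, `differential_ι_mul`,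
`differential_xv` and `differential_xe` below it is the odd derivation with
`Q x_i^* = 0` and `Q x_{i,j}^* = x_i^* x_j^*`; by `contract_differential_ι` it is the dual of the
Lie bracket on `1`-forms. -/
noncomputable def differential : Cochains G →ₗ[ℝ] Cochains G :=
  ∑ e : Edge G, LinearMap.mulLeft ℝ (xv G e.src * xv G e.tgt) ∘ₗ
    CliffordAlgebra.contractLeft (Module.Dual.eval ℝ (LieAlg G) (edgeVec G e))

theorem differential_apply (a : Cochains G) :
    differential G a = ∑ e : Edge G, xv G e.src * xv G e.tgt *
      CliffordAlgebra.contractLeft (Q := 0)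
        (Module.Dual.eval ℝ (LieAlg G) (edgeVec G e)) a := by
  rw [differential, LinearMap.sum_apply]
  rfl

theorem differential_one : differential G 1 = 0 := by
  simp [differential_apply]

theorem differential_algebraMap (r : ℝ) : differential G (algebraMap ℝ _ r) = 0 := by
  simp [differential_apply]

theorem differential_ι (ξ : Module.Dual ℝ (LieAlg G)) :
    differential G (ExteriorAlgebra.ι ℝ ξ) =
      ∑ e : Edge G, ξ (edgeVec G e) • (xv G e.src * xv G e.tgt) := by
  rw [differential_apply]
  refine Finset.sum_congr rfl fun e _ => ?_
  rw [contract_ι, Algebra.smul_def, ← Algebra.commutes]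
  rfl

theorem differential_ι_mul (ξ : Module.Dual ℝ (LieAlg G)) (a : Cochains G) :
    differential G (ExteriorAlgebra.ι ℝ ξ * a) =
      differential G (ExteriorAlgebra.ι ℝ ξ) * a
        - ExteriorAlgebra.ι ℝ ξ * differential G a := by
  rw [differential_ι, differential_apply, differential_apply, Finset.sum_mul, Finset.mul_sum,
    ← Finset.sum_sub_distrib]
  refine Finset.sum_congr rfl fun e _ => ?_
  rw [contract_ι_mul, mul_sub, mul_smul_comm, smul_mul_assoc, ← mul_assoc, ← mul_assoc, xv, xv,
    ι_mul_ι_mul_ι]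
  rfl

theorem differential_xv (i : V) : differential G (xv G i) = 0 := by
  rw [xv, differential_ι]
  refine Finset.sum_eq_zero fun e _ => ?_
  have : vertexDual G i (edgeVec G e) = 0 := rfl
  rw [this, zero_smul]

theorem differential_xe (e : Edge G) : differential G (xe G e) = xv G e.src * xv G e.tgt := by
  have key (f : Edge G) : edgeDual G e (edgeVec G f) = if e = f then 1 else 0 :=
    Pi.single_apply f (1 : ℝ) e
  simp only [xe, differential_ι, key, ite_smul, one_smul, zero_smul, Finset.sum_ite_eq,
    Finset.mem_univ, if_true]

/-- On `1`-forms the differential is the dual of the Lie bracket. -/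
theorem contract_differential_ι (ξ : Module.Dual ℝ (LieAlg G)) (a b : LieAlg G) :
    CliffordAlgebra.contractLeft (Q := 0) (Module.Dual.eval ℝ (LieAlg G) b)
      (CliffordAlgebra.contractLeft (Q := 0) (Module.Dual.eval ℝ (LieAlg G) a)
        (differential G (ExteriorAlgebra.ι ℝ ξ))) = algebraMap ℝ (Cochains G) (ξ ⁅a, b⁆) := by
  rw [lie_eq_sum, map_sum, map_sum, differential_ι, map_sum, map_sum]
  refine Finset.sum_congr rfl fun e _ => ?_
  have hv (c : LieAlg G) (i : V) : Module.Dual.eval ℝ (LieAlg G) c (vertexDual G i) = c.vert i := rfl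
  rw [map_smul, map_smul, map_smul, xv, xv, contract_ι_mul, contract_ι, map_sub, map_smul,
    contract_ι, ← Algebra.commutes, ← Algebra.smul_def, map_smul, contract_ι, hv, hv, hv, hv,
    smul_eq_mul]
  simp only [Algebra.smul_def, ← map_mul, ← map_sub]
  congr 1
  ring

theorem differential_xv_mul (i : V) (a : Cochains G) :
    differential G (xv G i * a) = -(xv G i * differential G a) := by
  have h := differential_xv G i
  rw [xv] at h ⊢
  rw [differential_ι_mul, h, zero_mul, zero_sub]

theorem differential_xe_mul (e : Edge G) (a : Cochains G) :
    differential G (xe G e * a) = xv G e.src * xv G e.tgt * a - xe G e * differential G a := by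
  have h := differential_xe G e
  rw [xe] at h ⊢
  rw [differential_ι_mul, h]

theorem differential_differential (a : Cochains G) :
    differential G (differential G a) = 0 := by
  induction a using CliffordAlgebra.left_induction with
  | algebraMap r =>
    have h := differential_algebraMap G r
    exact (congrArg (differential G) h).trans (map_zero _)
  | add x y hx hy => rw [map_add, map_add, hx, hy, add_zero]
  | ι_mul x m hx =>
    have h := differential_ι_mul G m x
    have h2 : differential G (differential G (ExteriorAlgebra.ι ℝ m) * x) =
        differential G (ExteriorAlgebra.ι ℝ m) * differential G x := by
      rw [differential_ι, Finset.sum_mul, Finset.sum_mul, map_sum]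
      refine Finset.sum_congr rfl fun e _ => ?_
      rw [smul_mul_assoc, map_smul, mul_assoc, differential_xv_mul, differential_xv_mul, mul_neg,
        neg_neg, smul_mul_assoc, mul_assoc]
    have h3 : differential G (differential G (ExteriorAlgebra.ι ℝ m * x)) = 0 := by
      rw [h, map_sub, h2, differential_ι_mul, hx, mul_zero, sub_zero, sub_self]
    exact h3

/-- The degree `k` part of the full complex: the `k`-th exterior power of the dual. -/
noncomputable def fullComplex (k : ℕ) : Submodule ℝ (Cochains G) :=
  ⋀[ℝ]^k (Module.Dual ℝ (LieAlg G))

/-- The degree `k` part of the subcomplex labelled by a set `S` of vertices: the span of the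
monomials `x_{i_1}^* ⋯ x_{i_p}^* x_{r_1,s_1}^* ⋯ x_{r_q,s_q}^*` with `p + q = k` and
`{i_1, …, i_p, r_1, s_1, …, r_q, s_q} = S`. For `S = ∅` it is zero by convention. -/
noncomputable def subcomplex (S : Set V) (k : ℕ) : Submodule ℝ (Cochains G) :=
  Submodule.span ℝ {ω | S.Nonempty ∧ ∃ (p : List V) (q : List (Edge G)),
    p.length + q.length = k ∧
    S = {v | v ∈ p ∨ ∃ e ∈ q, v = e.src ∨ v = e.tgt} ∧
    ω = (p.map (xv G)).prod * (q.map (xe G)).prod}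

theorem differential_mem_fullComplex (k : ℕ) (a : Cochains G) (ha : a ∈ fullComplex G k) :
    differential G a ∈ fullComplex G (k + 1) := by
  induction k generalizing a with
  | zero =>
    rw [fullComplex, ExteriorAlgebra.exteriorPower, pow_zero, Submodule.mem_one] at ha
    obtain ⟨r, rfl⟩ := ha
    rw [differential_algebraMap]
    exact Submodule.zero_mem _
  | succ k ih =>
    rw [fullComplex, ExteriorAlgebra.exteriorPower, pow_succ'] at ha
    induction ha using Submodule.mul_induction_on' with
    | mem_mul_mem m hm n hn =>
      obtain ⟨ξ, rfl⟩ := hm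
      rw [differential_ι_mul]
      refine Submodule.sub_mem _ ?_ ?_
      · rw [differential_ι, Finset.sum_mul]
        refine Submodule.sum_mem _ fun e _ => ?_
        rw [smul_mul_assoc, mul_assoc]
        refine Submodule.smul_mem _ _ ?_
        rw [fullComplex, ExteriorAlgebra.exteriorPower, pow_succ', pow_succ']
        exact Submodule.mul_mem_mul ⟨_, rfl⟩ (Submodule.mul_mem_mul ⟨_, rfl⟩ hn)
      · rw [fullComplex, ExteriorAlgebra.exteriorPower, pow_succ']
        exact Submodule.mul_mem_mul ⟨_, rfl⟩ (ih n hn)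
    | add x hx y hy h1 h2 => rw [map_add]; exact Submodule.add_mem _ h1 h2

theorem differential_xe_prod (q : List (Edge G)) :
    differential G (q.map (xe G)).prod ∈ Submodule.span ℝ
      {ω | ∃ (e : Edge G) (r : List (Edge G)), q.Perm (e :: r) ∧
        ω = xv G e.src * xv G e.tgt * (r.map (xe G)).prod} := by
  induction q with
  | nil => simp [differential_one]
  | cons f q ih =>
    rw [List.map_cons, List.prod_cons, differential_xe_mul]
    refine Submodule.sub_mem _ (Submodule.subset_span ⟨f, q, List.Perm.refl _, rfl⟩) ?_
    generalize differential G (q.map (xe G)).prod = y at ih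
    induction ih using Submodule.span_induction with
    | mem x hx =>
      obtain ⟨e, r, hq, rfl⟩ := hx
      refine Submodule.subset_span ⟨e, f :: r, (hq.cons f).trans (List.Perm.swap _ _ _), ?_⟩
      rw [List.map_cons, List.prod_cons, ← mul_assoc, ← mul_assoc, xe, xv, xv, mul_assoc (ExteriorAlgebra.ι ℝ _),
        ι_mul_ι_mul_ι, mul_assoc]
    | zero => rw [mul_zero]; exact Submodule.zero_mem _
    | add x y _ _ hx hy => rw [mul_add]; exact Submodule.add_mem _ hx hy
    | smul c x _ hx => rw [mul_smul_comm]; exact Submodule.smul_mem _ _ hx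

theorem differential_xv_prod_mul (p : List V) (a : Cochains G) :
    differential G ((p.map (xv G)).prod * a) =
      (-1 : ℝ) ^ p.length • ((p.map (xv G)).prod * differential G a) := by
  induction p with
  | nil => simp
  | cons i p ih =>
    rw [List.map_cons, List.prod_cons, mul_assoc, differential_xv_mul, ih, mul_smul_comm,
      List.length_cons, pow_succ, mul_neg_one, neg_smul, mul_assoc]

theorem differential_mem_subcomplex (S : Set V) (k : ℕ) (a : Cochains G)
    (ha : a ∈ subcomplex G S k) : differential G a ∈ subcomplex G S (k + 1) := by
  induction ha using Submodule.span_induction with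
  | mem x hx =>
    obtain ⟨hS, p, q, hk, hpq, rfl⟩ := hx
    rw [differential_xv_prod_mul]
    refine Submodule.smul_mem _ _ ?_
    have h := differential_xe_prod G q
    generalize differential G (q.map (xe G)).prod = y at h
    induction h using Submodule.span_induction with
    | mem x hx =>
      obtain ⟨e, r, hq, rfl⟩ := hx
      refine Submodule.subset_span ⟨hS, p ++ [e.src, e.tgt], r, ?_, ?_, ?_⟩
      · have := hq.length_eq
        simp only [List.length_cons, List.length_append, List.length_nil] at this ⊢
        omega
      · rw [hpq]
        ext v
        simp only [Set.mem_ofPred_eq, hq.mem_iff, List.mem_cons, List.mem_append, List.not_mem_nil,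
          exists_eq_or_imp, or_false, or_assoc]
      · simp [mul_assoc]
    | zero => rw [mul_zero]; exact Submodule.zero_mem _
    | add x y _ _ hx hy => rw [mul_add]; exact Submodule.add_mem _ hx hy
    | smul c x _ hx => rw [mul_smul_comm]; exact Submodule.smul_mem _ _ hx
  | zero => rw [map_zero]; exact Submodule.zero_mem _
  | add x y _ _ hx hy => rw [map_add]; exact Submodule.add_mem _ hx hy
  | smul c x _ hx => rw [map_smul]; exact Submodule.smul_mem _ _ hx

/-! ## Cohomology -/

/-- The cocycles of degree `k` of a subcomplex `C`. -/
noncomputable def cocycles (C : ℕ → Submodule ℝ (Cochains G)) (k : ℕ) :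
    Submodule ℝ (Cochains G) :=
  C k ⊓ LinearMap.ker (differential G)

/-- The coboundaries of degree `k` of a subcomplex `C`. -/
noncomputable def coboundaries (C : ℕ → Submodule ℝ (Cochains G)) :
    ℕ → Submodule ℝ (Cochains G)
  | 0 => ⊥
  | k + 1 => (C k).map (differential G)

theorem coboundaries_le_cocycles (C : ℕ → Submodule ℝ (Cochains G))
    (hC : ∀ k, ∀ a ∈ C k, differential G a ∈ C (k + 1)) (k : ℕ) :
    coboundaries G C k ≤ cocycles G C k := by
  cases k with
  | zero => exact bot_le
  | succ k =>
    rintro _ ⟨a, ha, rfl⟩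
    exact ⟨hC k a ha, differential_differential G a⟩

/-- The `k`-th cohomology (cocycles modulo coboundaries) of a subcomplex `C`. -/
abbrev Cohomology (C : ℕ → Submodule ℝ (Cochains G)) (k : ℕ) : Type _ :=
  cocycles G C k ⧸ (coboundaries G C k).submoduleOf (cocycles G C k)

/-- `b_k(G)`, the dimension of the `k`-th cohomology of the Lie algebra of `G`. -/
noncomputable def betti (k : ℕ) : ℕ :=
  Module.finrank ℝ (Cohomology G (fullComplex G) k)

/-- `β_k(G)`, the dimension of the `k`-th essential cohomology of `G`. -/
noncomputable def essentialBetti (k : ℕ) : ℕ :=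
  Module.finrank ℝ (Cohomology G (subcomplex G Set.univ) k)

end Complex

/-! ## Induced copies and the list of 23 graphs -/

/-- The number of occurrences of `H` as an induced subgraph of `G`: the number of sets of vertices
of `G` that induce a graph isomorphic to `H`. -/
noncomputable def inducedCount {V W : Type*} (G : SimpleGraph V) (H : SimpleGraph W) : ℕ :=
  Nat.card {S : Set V // Nonempty (G.induce S ≃g H)}

/-- The graph on the vertices `0, …, n - 1` with the listed edges. -/
def listGraph (n : ℕ) (l : List (ℕ × ℕ)) : SimpleGraph (Fin n) :=
  SimpleGraph.fromRel fun i j => ((i : ℕ), (j : ℕ)) ∈ l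

/-- The numbers of vertices of the 23 graphs. -/
def graphOrder : Fin 23 → ℕ :=
  ![2, 3, 3, 3, 3, 4, 4, 4, 4, 4, 4, 4, 4, 5, 5, 5, 5, 5, 5, 5, 5, 5, 5]

/-- The edges of the 23 graphs. -/
def graphEdges : Fin 23 → List (ℕ × ℕ) := ![
  [(0, 1)],
  [],
  [(0, 1)],
  [(0, 1), (1, 2)],
  [(0, 1), (1, 2), (0, 2)],
  [(0, 1), (1, 2)],
  [(0, 1), (1, 2), (2, 3)],
  [(0, 1), (1, 2), (2, 3), (0, 3)],
  [(0, 1), (1, 2), (0, 2)],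
  [(0, 1), (1, 2), (1, 3)],
  [(0, 1), (1, 2), (2, 3), (0, 2)],
  [(0, 1), (1, 2), (2, 3), (0, 3), (0, 2)],
  [(0, 1), (1, 2), (2, 3), (0, 3), (0, 2), (1, 3)],
  [(3, 4), (0, 4), (0, 1), (1, 2), (2, 4), (1, 3)],
  [(3, 4), (0, 4), (0, 1), (1, 2), (2, 4), (1, 4), (1, 3)],
  [(3, 4), (0, 4), (0, 1), (1, 2), (2, 3)],
  [(3, 4), (0, 4), (0, 1), (1, 2), (2, 3), (2, 4)],
  [(3, 4), (0, 4), (0, 1), (1, 2), (2, 3), (2, 4), (1, 4)],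
  [(3, 4), (0, 4), (0, 1), (1, 2), (2, 3), (2, 4), (1, 3)],
  [(3, 4), (0, 4), (0, 1), (1, 2), (2, 3), (2, 4), (1, 4), (1, 3)],
  [(3, 4), (0, 4), (0, 1), (1, 2), (2, 3), (2, 4), (1, 4), (0, 3)],
  [(3, 4), (0, 4), (0, 1), (1, 2), (2, 3), (2, 4), (1, 4), (0, 3), (1, 3)],
  [(3, 4), (0, 4), (0, 1), (1, 2), (2, 3), (2, 4), (1, 4), (0, 3), (1, 3), (0, 2)]]

/-- The 23 graphs `G_1, …, G_23` (`graph j` is `G_{j+1}`). -/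
def graph (j : Fin 23) : SimpleGraph (Fin (graphOrder j)) :=
  listGraph (graphOrder j) (graphEdges j)

/-- The weights `β_3(G_1), …, β_3(G_23)`. -/
def weight : Fin 23 → ℕ :=
  ![1, 1, 2, 4, 9, 1, 1, 5, 2, 2, 3, 8, 14, 1, 1, 1, 1, 1, 2, 2, 3, 4, 6]

end DaniMainkar

namespace DaniMainkar

/-! ## Monomials in an exterior algebra -/

section Monomials

open ExteriorAlgebra Module

variable {R M I : Type*} [CommRing R] [AddCommGroup M] [Module R M]

/-! The differential trades an edge variable for the product of its two endpoints, so it preserves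
the set of vertices that occur in a monomial. In positive degree the cochains are therefore the
direct sum of the subcomplexes labelled by the nonempty vertex sets `S`, and the subcomplex of `S`
is a copy of the essential complex of the induced graph `G[S]` (`map_subcomplex`,
`finrank_cohomology_range`). Hence `b_k(G)` is the sum of `β_k(G[S])` over all `S` for `k ≥ 2`
(`betti_eq_sum_induce`), and grouping the sets `S` by isomorphism type reduces everything to finding
all graphs with `β_3 ≠ 0`.

Three variables cover at most six vertices, so `β_3` vanishes above six vertices. On exactly six
vertices the essential 3-cochains are spanned by perfect matchings. The differential is injective on
the 15 matchings of `K_6`, and every graph on six vertices has its cochains embedded in those of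
`K_6`, so it has no essential 3-cocycles at all (`essentialBetti_fin_six`).

At most five vertices leave a finite problem, settled by kernel evaluation. Cochains are modelled by
integer combinations of increasing lists of variable numbers, and fraction-free Gaussian elimination
computes the ranks of the differential in degrees 2 and 3 (`finrank_rowSpan`,
`essentialBetti_eq_of_computeBetti`). That the listed representatives exhaust all isomorphism types
is certified by relabelling them in all ways and checking that every edge set appears
(`bitsOf_orbitMasks`, `exists_iso_listGraph`). The 23 graphs are told apart by their order and two
counts of walks (`graph_iso_injective`). -/

theorem prod_ι_perm (v : I → M) {l l' : List I} (h : l.Perm l') :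
    (l.map fun i => ι R (v i)).prod = (l'.map fun i => ι R (v i)).prod ∨
      (l.map fun i => ι R (v i)).prod = -(l'.map fun i => ι R (v i)).prod := by
  induction h with
  | nil => exact Or.inl rfl
  | cons a _ ih => rcases ih with ih | ih <;> simp [ih]
  | swap a b l =>
    right
    simp only [List.map_cons, List.prod_cons, ← mul_assoc]
    rw [eq_neg_of_add_eq_zero_left (ι_add_mul_swap (R := R) (v b) (v a)), neg_mul]
  | trans _ _ h₁ h₂ => rcases h₁ with h₁ | h₁ <;> rcases h₂ with h₂ | h₂ <;> simp [h₁, h₂]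

/-- A permutation brings two equal factors to the front, at the cost of a sign, and their product is
zero. -/
theorem prod_ι_of_not_nodup (v : I → M) {l : List I} (h : ¬ l.Nodup) :
    (l.map fun i => ι R (v i)).prod = 0 := by
  obtain ⟨a, ha⟩ := List.exists_duplicate_iff_not_nodup.2 h
  obtain ⟨t, ht⟩ := (List.duplicate_iff_sublist.1 ha).exists_perm_append
  rcases prod_ι_perm (R := R) v ht with h | h <;>
    simp [h, ← mul_assoc]

/-- Allowing a sign makes the statement independent of any order on `I`: every enumeration of `s`
gives the same basis vector up to sign, which is all that spans and dimensions need. -/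
theorem exists_monomialBasis (b : Basis I R M) :
    ∃ B : Basis (Finset I) R (ExteriorAlgebra R M), ∀ (s : Finset I) (l : List I), l.Nodup →
      (∀ i, i ∈ l ↔ i ∈ s) → (l.map fun i => ι R (b i)).prod = B s ∨
        (l.map fun i => ι R (b i)).prod = -B s := by
  classical
  -- The index type carries no order; an arbitrary well-order serves to invoke the ordered basis.
  let _ : LinearOrder I := IsWellOrder.linearOrder WellOrderingRel
  refine ⟨b.ExteriorAlgebra, fun s l hl hs => ?_⟩
  have hB : b.ExteriorAlgebra s = (s.sort.map fun i => ι R (b i)).prod := by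
    rw [basis_apply]
    simp only [ιMulti_family, ιMulti_apply]
    congr 1
    refine List.ext_getElem (by simp) fun i h₁ h₂ => ?_
    simp [Set.powersetCard.ofFinEmbEquiv_symm_apply, Finset.orderEmbOfFin_apply]
  rw [hB]
  refine prod_ι_perm b ((List.perm_ext_iff_of_nodup hl (Finset.sort_nodup ..)).2 fun i => ?_)
  rw [hs, Finset.mem_sort]

/-- The basis of the exterior algebra formed by the products of basis vectors. -/
noncomputable def monomialBasis (b : Basis I R M) : Basis (Finset I) R (ExteriorAlgebra R M) :=
  (exists_monomialBasis b).choose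

theorem prod_ι_eq (b : Basis I R M) {s : Finset I} {l : List I} (hl : l.Nodup)
    (hs : ∀ i, i ∈ l ↔ i ∈ s) : (l.map fun i => ι R (b i)).prod = monomialBasis b s ∨
      (l.map fun i => ι R (b i)).prod = -monomialBasis b s :=
  (exists_monomialBasis b).choose_spec s l hl hs

end Monomials

/-! ## The monomial basis of the cochains of a graph -/

section GraphMonomials

open Module

variable {V : Type*} [LinearOrder V] (G : SimpleGraph V)

/-- The generators of the algebra of cochains. -/
abbrev Gen : Type _ := V ⊕ Edge G

variable {G} in
/-- The basis of the dual of the Lie algebra, as a family. -/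
noncomputable def genDual : Gen G → Dual ℝ (LieAlg G) := Sum.elim (vertexDual G) (edgeDual G)

variable {G} in
/-- The vertices that occur in a generator. -/
def Gen.supp : Gen G → Set V := Sum.elim (fun v => {v}) (fun e => {e.src, e.tgt})

theorem lieAlg_eq_sum [Fintype V] (a : LieAlg G) :
    a = ∑ i, a.vert i • vertexVec G i + ∑ e, a.edge e • edgeVec G e := by
  have hv (i : V) (b : LieAlg G) : b.vert i = vertexDual G i b := rfl
  have he (e : Edge G) (b : LieAlg G) : b.edge e = edgeDual G e b := rfl
  ext f
  · rw [hv f, hv f, map_add, map_sum, map_sum]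
    simp [vertexVec, edgeVec, Pi.single_apply]
  · rw [he f, he f, map_add, map_sum, map_sum]
    simp [vertexVec, edgeVec, Pi.single_apply]

variable {G}

/-- A generator as a cochain. -/
noncomputable def gen (g : Gen G) : Cochains G := ExteriorAlgebra.ι ℝ (genDual g)

theorem gen_prod_of_not_nodup {l : List (Gen G)} (hl : ¬ l.Nodup) : (l.map gen).prod = 0 :=
  prod_ι_of_not_nodup genDual hl

theorem mem_supp_iff {p : List V} {q : List (Edge G)} {v : V} :
    (∃ g ∈ p.map Sum.inl ++ q.map Sum.inr, v ∈ Gen.supp (G := G) g) ↔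
      v ∈ p ∨ ∃ e ∈ q, v = e.src ∨ v = e.tgt := by
  simp [or_and_right, exists_or, Gen.supp]

theorem exists_sublists (l : List (Gen G)) : ∃ (p : List V) (q : List (Edge G)),
    l.Perm (p.map Sum.inl ++ q.map Sum.inr) := by
  induction l with
  | nil => exact ⟨[], [], List.Perm.refl _⟩
  | cons g l ih =>
    obtain ⟨p, q, h⟩ := ih
    rcases g with v | e
    · exact ⟨v :: p, q, h.cons _⟩
    · exact ⟨p, e :: q, (h.cons _).trans List.perm_middle.symm⟩

theorem map_gen_prod (p : List V) (q : List (Edge G)) :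
    ((p.map Sum.inl ++ q.map Sum.inr).map (gen (G := G))).prod =
      (p.map (xv G)).prod * (q.map (xe G)).prod := by
  simp only [List.map_append, List.map_map, List.prod_append]
  rfl

variable (G)

variable [Finite V]

theorem dual_eq_sum [Fintype V] (ξ : Dual ℝ (LieAlg G)) :
    ξ = ∑ i, ξ (vertexVec G i) • vertexDual G i + ∑ e, ξ (edgeVec G e) • edgeDual G e := by
  ext a
  conv_lhs => rw [lieAlg_eq_sum G a]
  simp [LinearMap.add_apply, LinearMap.sum_apply, mul_comm]

theorem linearIndependent_genDual : LinearIndependent ℝ (genDual (G := G)) := by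
  classical
  have := Fintype.ofFinite V
  rw [Fintype.linearIndependent_iff]
  intro c hc
  simp only [Fintype.sum_sum_type, genDual, Sum.elim_inl, Sum.elim_inr] at hc
  rintro (i | e)
  · have := LinearMap.congr_fun hc (vertexVec G i)
    simpa [LinearMap.add_apply, LinearMap.sum_apply, vertexVec, Pi.single_apply] using this
  · have := LinearMap.congr_fun hc (edgeVec G e)
    simpa [LinearMap.add_apply, LinearMap.sum_apply, edgeVec, Pi.single_apply] using this

/-- The basis of the dual of the Lie algebra. -/
noncomputable def genBasis : Basis (Gen G) ℝ (Dual ℝ (LieAlg G)) :=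
  Basis.mk (linearIndependent_genDual G) fun ξ _ => by
    have := Fintype.ofFinite V
    rw [dual_eq_sum G ξ]
    exact Submodule.add_mem _
      (Submodule.sum_mem _ fun i _ => Submodule.smul_mem _ _ (Submodule.subset_span ⟨Sum.inl i, rfl⟩))
      (Submodule.sum_mem _ fun e _ => Submodule.smul_mem _ _ (Submodule.subset_span ⟨Sum.inr e, rfl⟩))

/-- The basis of the cochains formed by the monomials. -/
noncomputable def cochainBasis : Basis (Finset (Gen G)) ℝ (Cochains G) :=
  monomialBasis (genBasis G)

instance : Module.Finite ℝ (Cochains G) := Module.Finite.of_basis (cochainBasis G)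

variable {G}

theorem gen_prod_eq {s : Finset (Gen G)} {l : List (Gen G)} (hl : l.Nodup)
    (hs : ∀ i, i ∈ l ↔ i ∈ s) :
    (l.map gen).prod = cochainBasis G s ∨ (l.map gen).prod = -cochainBasis G s := by
  have h : gen (G := G) = fun g => ExteriorAlgebra.ι ℝ (genBasis G g) := by
    ext g; simp [gen, genBasis]
  rw [h]
  exact prod_ι_eq (genBasis G) hl hs

/-- Only repetition-free lists need to be checked, since a repeated factor makes the product zero.
-/
theorem gen_prod_mem_span {l : List (Gen G)} {A : Set (Finset (Gen G))}
    (h : l.Nodup → ∃ s ∈ A, ∀ g, g ∈ l ↔ g ∈ s) :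
    (l.map gen).prod ∈ Submodule.span ℝ (cochainBasis G '' A) := by
  by_cases hl : l.Nodup
  · obtain ⟨s, hs, hls⟩ := h hl
    have hm := Submodule.subset_span (R := ℝ) (Set.mem_image_of_mem (cochainBasis G) hs)
    rcases gen_prod_eq hl hls with h | h <;> rw [h]
    exacts [hm, Submodule.neg_mem _ hm]
  · rw [gen_prod_of_not_nodup hl]
    exact Submodule.zero_mem _

theorem cochainBasis_mem_of_prod_mem {s : Finset (Gen G)} {l : List (Gen G)} (hl : l.Nodup)
    (hs : ∀ i, i ∈ l ↔ i ∈ s) {C : Submodule ℝ (Cochains G)} (h : (l.map gen).prod ∈ C) :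
    cochainBasis G s ∈ C := by
  rcases gen_prod_eq hl hs with h' | h' <;> rw [h'] at h
  exacts [h, neg_mem_iff.1 h]

variable (G) in
theorem fullComplex_eq_span (k : ℕ) :
    fullComplex G k = Submodule.span ℝ (cochainBasis G '' {s | s.card = k}) := by
  classical
  apply le_antisymm
  -- The range of `ι` is spanned by the generators, so its `k`-th power is spanned by their `k`-fold
  -- products.
  · have htop : LinearMap.range (ExteriorAlgebra.ι ℝ (M := Dual ℝ (LieAlg G))) =
        Submodule.span ℝ (Set.range (gen (G := G))) := by
      have h : (gen (G := G)) = ExteriorAlgebra.ι ℝ ∘ genBasis G := by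
        ext g; simp [gen, genBasis]
      rw [h, Set.range_comp, ← Submodule.map_span, (genBasis G).span_eq, Submodule.map_top]
    rw [fullComplex, ExteriorAlgebra.exteriorPower, htop, Submodule.span_pow, Submodule.span_le]
    intro x hx
    obtain ⟨l, hl, rfl⟩ : ∃ l : List (Gen G), l.length = k ∧ (l.map gen).prod = x := by
      obtain ⟨f, rfl⟩ := Set.mem_pow.1 hx
      choose g hg using fun i => (f i).2
      refine ⟨List.ofFn g, by simp, ?_⟩
      rw [List.map_ofFn]
      congr 2
      ext i
      exact hg i
    refine gen_prod_mem_span fun hn => ⟨l.toFinset, ?_, by simp⟩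
    simpa [List.toFinset_card_of_nodup hn] using hl
  · rw [Submodule.span_le]
    rintro _ ⟨s, rfl, rfl⟩
    refine cochainBasis_mem_of_prod_mem s.nodup_toList (fun _ => Finset.mem_toList) ?_
    rw [← s.length_toList, fullComplex, ExteriorAlgebra.exteriorPower]
    generalize s.toList = l
    induction l with
    | nil => simp
    | cons a l ih =>
      rw [List.map_cons, List.prod_cons, List.length_cons, pow_succ']
      exact Submodule.mul_mem_mul ⟨_, rfl⟩ ih

variable (G) in
theorem subcomplex_eq_span (S : Set V) (k : ℕ) : subcomplex G S k =
    Submodule.span ℝ (cochainBasis G ''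
      {s | s.card = k ∧ S.Nonempty ∧ S = {v | ∃ g ∈ s, v ∈ Gen.supp g}}) := by
  classical
  apply le_antisymm
  · rw [subcomplex, Submodule.span_le]
    rintro _ ⟨hS, p, q, hk, hpq, rfl⟩
    rw [← map_gen_prod]
    refine gen_prod_mem_span fun hn => ⟨_, ⟨(List.toFinset_card_of_nodup hn).trans ?_, hS, ?_⟩,
      fun g => List.mem_toFinset.symm⟩
    · simpa using hk
    · rw [hpq]
      ext v
      simp only [List.mem_toFinset]
      exact mem_supp_iff.symm
  · rw [Submodule.span_le]
    rintro _ ⟨s, ⟨rfl, hS, hs⟩, rfl⟩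
    obtain ⟨p, q, h⟩ := exists_sublists s.toList
    refine cochainBasis_mem_of_prod_mem (l := p.map Sum.inl ++ q.map Sum.inr)
      (h.nodup_iff.1 s.nodup_toList) (fun g => ?_) ?_
    · rw [← h.mem_iff, Finset.mem_toList]
    · rw [map_gen_prod]
      refine Submodule.subset_span ⟨hS, p, q, ?_, ?_, rfl⟩
      · simpa using h.length_eq.symm
      · rw [hs]
        ext v
        refine Iff.trans ?_ mem_supp_iff
        simp only [← h.mem_iff, Finset.mem_toList]
        rfl

end GraphMonomials

/-! ## Independent families of submodules -/

section Independent

open Module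

variable {K M N ι : Type*} [Field K] [AddCommGroup M] [Module K M] [AddCommGroup N] [Module K N]

theorem iSupIndep_span_image {κ : Type*} {v : κ → M} (hv : LinearIndependent K v)
    {A : ι → Set κ} (hA : Pairwise fun i j => Disjoint (A i) (A j)) :
    iSupIndep fun i => Submodule.span K (v '' A i) := by
  intro i
  have : ⨆ j, ⨆ (_ : j ≠ i), Submodule.span K (v '' A j) =
      Submodule.span K (v '' ⋃ j, ⋃ (_ : j ≠ i), A j) := by
    simp only [Set.image_iUnion, Submodule.span_iUnion]
  rw [this]
  refine hv.disjoint_span_image ?_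
  simp only [Set.disjoint_iUnion_right]
  exact fun j hj => hA hj.symm

theorem finrank_iSup_of_iSupIndep [Fintype ι] [FiniteDimensional K M] {C : ι → Submodule K M}
    (hC : iSupIndep C) : finrank K (⨆ i, C i : Submodule K M) = ∑ i, finrank K (C i) := by
  classical
  rw [← Finset.sup_univ_eq_iSup]
  have h (s : Finset ι) : finrank K (s.sup C : Submodule K M) = ∑ i ∈ s, finrank K (C i) := by
    induction s using Finset.induction_on with
    | empty => simp
    | insert a s ha ih =>
      have hd : Disjoint (C a) (s.sup C) :=
        hC.supIndep' (insert a s) (Finset.subset_insert a s) (Finset.mem_insert_self a s) ha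
      have := Submodule.finrank_sup_add_finrank_inf_eq (C a) (s.sup C)
      rw [hd.eq_bot, finrank_bot, add_zero] at this
      rw [Finset.sup_insert, this, Finset.sum_insert ha, ih]
  exact h _

theorem eq_zero_of_sum_eq_zero [Fintype ι] {C : ι → Submodule K M} (hC : iSupIndep C)
    {y : ι → M} (hy : ∀ i, y i ∈ C i) (h : ∑ i, y i = 0) (i : ι) : y i = 0 := by
  classical
  refine Submodule.disjoint_def.1 (hC i) _ (hy i) ?_
  rw [← Finset.add_sum_erase _ _ (Finset.mem_univ i)] at h
  rw [eq_neg_of_add_eq_zero_left h]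
  refine Submodule.neg_mem _ (Submodule.sum_mem _ fun j hj => ?_)
  exact Submodule.mem_iSup_of_mem j (Submodule.mem_iSup_of_mem (Finset.ne_of_mem_erase hj) (hy j))

/-- If `x` is a sum of components in the `C i`, then the images of the components lie in the
independent spaces `D i` and add up to zero, so each of them is zero. -/
theorem iSup_inf_ker [Fintype ι] {C : ι → Submodule K M} {D : ι → Submodule K N}
    (hD : iSupIndep D) (d : M →ₗ[K] N) (hd : ∀ i, ∀ a ∈ C i, d a ∈ D i) :
    (⨆ i, C i) ⊓ LinearMap.ker d = ⨆ i, C i ⊓ LinearMap.ker d := by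
  apply le_antisymm
  · rintro x ⟨hx, hdx⟩
    obtain ⟨f, hf, rfl⟩ := (Submodule.mem_iSup_iff_exists_finsupp _ _).1 hx
    rw [Finsupp.sum_fintype _ _ fun _ => rfl] at hdx ⊢
    refine Submodule.sum_mem _ fun i _ => Submodule.mem_iSup_of_mem i ⟨hf i, ?_⟩
    refine eq_zero_of_sum_eq_zero hD (y := fun i => d (f i)) (fun i => hd i _ (hf i)) ?_ i
    rw [← map_sum]
    exact hdx
  · exact iSup_le fun i => inf_le_inf_right _ (le_iSup C i)

end Independent

/-! ## Decomposition of the cohomology by supports -/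

section Decomposition

open Module

variable {V : Type*} [LinearOrder V] [Finite V] (G : SimpleGraph V)

theorem finrank_cohomology (C : ℕ → Submodule ℝ (Cochains G))
    (hC : ∀ k, ∀ a ∈ C k, differential G a ∈ C (k + 1)) (k : ℕ) :
    finrank ℝ (Cohomology G C k) + finrank ℝ (coboundaries G C k) =
      finrank ℝ (cocycles G C k) := by
  rw [← Submodule.finrank_quotient_add_finrank
    ((coboundaries G C k).submoduleOf (cocycles G C k)),
    (Submodule.submoduleOfEquivOfLe (coboundaries_le_cocycles G C hC k)).finrank_eq]

/-- A basis monomial has only one support, so different labels use disjoint sets of basis vectors.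
-/
theorem iSupIndep_subcomplex (k : ℕ) : iSupIndep fun S : Set V => subcomplex G S k := by
  simp only [subcomplex_eq_span]
  refine iSupIndep_span_image (cochainBasis G).linearIndependent fun S T hST => ?_
  refine Set.disjoint_left.2 ?_
  rintro s ⟨-, -, hS⟩ ⟨-, -, hT⟩
  exact hST (hS.trans hT.symm)

/-- Degree zero is excluded because the monomial `1` has empty support, and the summand of the empty
set is zero by convention. -/
theorem fullComplex_eq_iSup (k : ℕ) (hk : k ≠ 0) :
    fullComplex G k = ⨆ S : Set V, subcomplex G S k := by
  simp only [subcomplex_eq_span, fullComplex_eq_span, ← Submodule.span_iUnion, ← Set.image_iUnion]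
  congr 2
  ext s
  simp only [Set.mem_iUnion, Set.mem_ofPred_eq]
  constructor
  · rintro rfl
    refine ⟨_, rfl, ?_, rfl⟩
    obtain ⟨g, hg⟩ := Finset.card_ne_zero.1 hk
    rcases g with v | e
    exacts [⟨v, _, hg, rfl⟩, ⟨e.src, _, hg, Or.inl rfl⟩]
  · rintro ⟨_, h, _⟩
    exact h

/-- Cocycles and coboundaries both split along the supports. The coboundaries of degree `k` come
from degree `k - 1`, which must itself be positive for the splitting; hence `2 ≤ k`. -/
theorem betti_eq_sum [Fintype (Set V)] (k : ℕ) (hk : 2 ≤ k) :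
    betti G k = ∑ S : Set V, finrank ℝ (Cohomology G (subcomplex G S) k) := by
  obtain ⟨k, rfl⟩ : ∃ m, k = m + 1 := ⟨k - 1, by omega⟩
  have h₁ : betti G (k + 1) + _ = _ :=
    finrank_cohomology G _ (differential_mem_fullComplex G) (k + 1)
  have h₂ (S : Set V) := finrank_cohomology G _ (differential_mem_subcomplex G S) (k + 1)
  have h₃ : cocycles G (fullComplex G) (k + 1) =
      ⨆ S : Set V, cocycles G (subcomplex G S) (k + 1) := by
    simp only [cocycles]
    rw [fullComplex_eq_iSup G _ (by omega)]
    exact iSup_inf_ker (iSupIndep_subcomplex G (k + 2)) _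
      fun S => differential_mem_subcomplex G S (k + 1)
  have h₄ : coboundaries G (fullComplex G) (k + 1) =
      ⨆ S : Set V, coboundaries G (subcomplex G S) (k + 1) := by
    simp only [coboundaries]
    rw [fullComplex_eq_iSup G _ (by omega), Submodule.map_iSup]
  have h₅ : iSupIndep fun S : Set V => cocycles G (subcomplex G S) (k + 1) :=
    (iSupIndep_subcomplex G (k + 1)).mono fun S => inf_le_left
  have h₆ : iSupIndep fun S : Set V => coboundaries G (subcomplex G S) (k + 1) :=
    h₅.mono fun S => coboundaries_le_cocycles G _ (differential_mem_subcomplex G S) _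
  rw [h₃, h₄, finrank_iSup_of_iSupIndep h₅, finrank_iSup_of_iSupIndep h₆] at h₁
  simp only [← h₂, Finset.sum_add_distrib] at h₁
  exact Nat.add_right_cancel h₁

end Decomposition

/-! ## Functoriality -/

section Functoriality

open Module

variable {W V : Type*} [LinearOrder W] [LinearOrder V] {H : SimpleGraph W} {G : SimpleGraph V}
  (φ : H →g G)

theorem lt_of_not_map_lt (hφ : Function.Injective φ) {e : Edge H} (h : ¬ φ e.src < φ e.tgt) : φ e.tgt < φ e.src :=
  lt_of_le_of_ne (not_lt.1 h) fun h' => e.lt.ne' (hφ h')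

variable (hφ : Function.Injective φ)

/-- The image of an edge under an injective homomorphism of graphs. -/
def edgeMap (e : Edge H) : Edge G :=
  if h : φ e.src < φ e.tgt then ⟨φ e.src, φ e.tgt, h, φ.map_adj e.adj⟩
  else ⟨φ e.tgt, φ e.src, lt_of_not_map_lt φ hφ h, (φ.map_adj e.adj).symm⟩

/-- `1` if the homomorphism preserves the order of the endpoints of the edge, `-1` otherwise. -/
def edgeSign (e : Edge H) : ℝ := if φ e.src < φ e.tgt then 1 else -1

theorem edgeSign_ne_zero (e : Edge H) : edgeSign φ e ≠ 0 := by
  unfold edgeSign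
  split_ifs <;> norm_num

theorem edgeSign_mul_self (e : Edge H) : edgeSign φ e * edgeSign φ e = 1 := by
  unfold edgeSign
  split_ifs <;> norm_num

theorem mem_edgeMap_iff (e : Edge H) (v : V) :
    v = (edgeMap φ hφ e).src ∨ v = (edgeMap φ hφ e).tgt ↔ v = φ e.src ∨ v = φ e.tgt := by
  unfold edgeMap
  split_ifs
  exacts [Iff.rfl, or_comm]

theorem edgeMap_injective : Function.Injective (edgeMap φ hφ) := by
  intro e f h
  unfold edgeMap at h
  split_ifs at h <;> simp only [Edge.mk.injEq, hφ.eq_iff] at h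
  · exact Edge.ext h.1 h.2
  · exact absurd e.lt (by rw [h.1, h.2]; exact f.lt.not_gt)
  · exact absurd e.lt (by rw [h.1, h.2]; exact f.lt.not_gt)
  · exact Edge.ext h.2 h.1

/-- The restriction of coordinates along an injective homomorphism of graphs. -/
def lieRestrict : LieAlg G →ₗ[ℝ] LieAlg H where
  toFun a := ⟨fun i => a.vert (φ i), fun e => edgeSign φ e * a.edge (edgeMap φ hφ e)⟩
  map_add' a b := by ext <;> simp [mul_add]
  map_smul' c a := by ext <;> simp [mul_left_comm]

theorem lieRestrict_vert (a : LieAlg G) (i : W) : (lieRestrict φ hφ a).vert i = a.vert (φ i) := rfl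

theorem lieRestrict_edge (a : LieAlg G) (e : Edge H) :
    (lieRestrict φ hφ a).edge e = edgeSign φ e * a.edge (edgeMap φ hφ e) := rfl

/-- Extension by zero is a section; the edge signs are undone by multiplying with them once more.
Surjectivity makes the dual map, and then the map of exterior algebras, injective. -/
theorem lieRestrict_surjective : Function.Surjective (lieRestrict φ hφ) := by
  intro b
  refine ⟨⟨Function.extend φ b.vert fun _ => 0,
    Function.extend (edgeMap φ hφ) (fun e => edgeSign φ e * b.edge e) fun _ => 0⟩, ?_⟩
  ext i
  · rw [lieRestrict_vert]
    dsimp only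
    rw [hφ.extend_apply]
  · rw [lieRestrict_edge]
    dsimp only
    rw [(edgeMap_injective φ hφ).extend_apply, ← mul_assoc, edgeSign_mul_self, one_mul]

/-- The homomorphism of cochain algebras induced by an injective homomorphism of graphs. -/
noncomputable def cochainMap : Cochains H →ₐ[ℝ] Cochains G :=
  ExteriorAlgebra.map (lieRestrict φ hφ).dualMap

theorem cochainMap_injective : Function.Injective (cochainMap φ hφ) :=
  ExteriorAlgebra.map_injective_field <| LinearMap.ker_eq_bot.2 <|
    LinearMap.dualMap_injective_of_surjective (lieRestrict_surjective φ hφ)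

theorem cochainMap_xv (i : W) : cochainMap φ hφ (xv H i) = xv G (φ i) := by
  rw [cochainMap, xv, ExteriorAlgebra.map_apply_ι]
  rfl

theorem cochainMap_xe (e : Edge H) :
    cochainMap φ hφ (xe H e) = edgeSign φ e • xe G (edgeMap φ hφ e) := by
  rw [cochainMap, xe, ExteriorAlgebra.map_apply_ι, xe, ← map_smul]
  rfl

/-- When `φ` reverses the endpoints of an edge, the sign cancels the one from swapping two odd
variables. This makes the induced map commute with the differential although `φ` need not be
monotone. -/
theorem xv_mul_xv_edgeMap (e : Edge H) :
    edgeSign φ e • (xv G (edgeMap φ hφ e).src * xv G (edgeMap φ hφ e).tgt) =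
      xv G (φ e.src) * xv G (φ e.tgt) := by
  unfold edgeSign edgeMap
  split_ifs
  · rw [one_smul]
  · rw [xv, xv, ι_mul_ι_swap, neg_smul, one_smul, neg_neg]

theorem cochainMap_prod (p : List W) (q : List (Edge H)) : ∃ c : ℝ, c ≠ 0 ∧
    cochainMap φ hφ ((p.map (xv H)).prod * (q.map (xe H)).prod) =
      c • (((p.map φ).map (xv G)).prod * ((q.map (edgeMap φ hφ)).map (xe G)).prod) := by
  induction p with
  | nil =>
    simp only [List.map_nil, List.prod_nil, one_mul]
    induction q with
    | nil => exact ⟨1, one_ne_zero, by simp⟩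
    | cons e q ih =>
      obtain ⟨c, hc, h⟩ := ih
      refine ⟨edgeSign φ e * c, mul_ne_zero (edgeSign_ne_zero φ e) hc, ?_⟩
      rw [List.map_cons, List.prod_cons, map_mul, h, cochainMap_xe, smul_mul_smul_comm]
      rfl
  | cons v p ih =>
    obtain ⟨c, hc, h⟩ := ih
    refine ⟨c, hc, ?_⟩
    rw [List.map_cons, List.prod_cons, mul_assoc, map_mul, h, cochainMap_xv, mul_smul_comm,
      ← mul_assoc]
    rfl

/-- An injective homomorphism suffices for this inclusion: `G` may have further edges on the image.
The comparison with `K_6` uses exactly this generality. -/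
theorem map_subcomplex_le (k : ℕ) :
    (subcomplex H Set.univ k).map (cochainMap φ hφ).toLinearMap ≤
      subcomplex G (Set.range φ) k := by
  rw [subcomplex, Submodule.map_span, Submodule.span_le]
  rintro _ ⟨_, ⟨hS, p, q, hk, hpq, rfl⟩, rfl⟩
  obtain ⟨c, -, h⟩ := cochainMap_prod φ hφ p q
  rw [AlgHom.toLinearMap_apply, h]
  refine Submodule.smul_mem _ _ (Submodule.subset_span
    ⟨Set.image_univ ▸ hS.image φ, _, _, by simpa using hk, ?_, rfl⟩)
  ext v
  rw [← Set.image_univ, hpq]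
  simp only [List.mem_map, Set.mem_image, Set.mem_ofPred_eq, exists_exists_and_eq_and,
    mem_edgeMap_iff]
  constructor
  · rintro ⟨w, hw | ⟨e, he, hw⟩, rfl⟩
    · exact Or.inl ⟨w, hw, rfl⟩
    · exact Or.inr ⟨e, he, hw.imp (congrArg φ) (congrArg φ)⟩
  · rintro (⟨w, hw, rfl⟩ | ⟨e, he, rfl | rfl⟩)
    · exact ⟨w, Or.inl hw, rfl⟩
    · exact ⟨_, Or.inr ⟨e, he, Or.inl rfl⟩, rfl⟩
    · exact ⟨_, Or.inr ⟨e, he, Or.inr rfl⟩, rfl⟩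

variable [Finite W] [Finite V]

theorem differential_cochainMap_ι (ξ : Dual ℝ (LieAlg H)) :
    differential G (cochainMap φ hφ (ExteriorAlgebra.ι ℝ ξ)) =
      cochainMap φ hφ (differential H (ExteriorAlgebra.ι ℝ ξ)) := by
  have := Fintype.ofFinite W
  rw [dual_eq_sum H ξ]
  simp only [map_add, map_sum, map_smul]
  congr 1
  · refine Finset.sum_congr rfl fun i _ => ?_
    rw [← xv, differential_xv, cochainMap_xv, differential_xv, map_zero]
  · refine Finset.sum_congr rfl fun e _ => ?_
    rw [← xe, differential_xe, cochainMap_xe, map_smul, differential_xe, map_mul, cochainMap_xv,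
      cochainMap_xv, xv_mul_xv_edgeMap]

theorem differential_cochainMap_ι_mul (ξ : Dual ℝ (LieAlg H)) (a : Cochains H)
    (ha : differential G (cochainMap φ hφ a) = cochainMap φ hφ (differential H a)) :
    differential G (cochainMap φ hφ (ExteriorAlgebra.ι ℝ ξ * a)) =
      cochainMap φ hφ (differential H (ExteriorAlgebra.ι ℝ ξ * a)) := by
  have h := differential_cochainMap_ι φ hφ ξ
  have hξ : cochainMap φ hφ (ExteriorAlgebra.ι ℝ ξ) =
      ExteriorAlgebra.ι ℝ ((lieRestrict φ hφ).dualMap ξ) := ExteriorAlgebra.map_apply_ι _ _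
  rw [differential_ι_mul, map_sub, map_mul (cochainMap φ hφ), map_mul (cochainMap φ hφ),
    map_mul (cochainMap φ hφ), ← ha, ← h, hξ, differential_ι_mul]

/-- Both differentials are odd derivations and the map is multiplicative, so agreement on the
generators propagates to all products. -/
theorem differential_cochainMap (a : Cochains H) :
    differential G (cochainMap φ hφ a) = cochainMap φ hφ (differential H a) := by
  induction a using CliffordAlgebra.left_induction with
  | algebraMap r =>
    have h := differential_algebraMap H r
    have h' := differential_algebraMap G r
    refine Eq.trans ?_ ((congrArg (cochainMap φ hφ) h).trans (map_zero _)).symm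
    refine Eq.trans ?_ h'
    congr 1
    exact (cochainMap φ hφ).commutes r
  | add x y hx hy => rw [map_add, map_add, map_add, map_add, hx, hy]
  | ι_mul x m hx => exact differential_cochainMap_ι_mul φ hφ m x hx

end Functoriality

/-! ### Induced subgraphs and invariance under isomorphism -/

section Embedding

open Module

variable {W V : Type*} [LinearOrder W] [LinearOrder V] {H : SimpleGraph W} {G : SimpleGraph V}

theorem exists_edgeMap_eq (φ : H ↪g G) {e : Edge G} (hs : e.src ∈ Set.range φ)
    (ht : e.tgt ∈ Set.range φ) : ∃ f : Edge H, edgeMap φ.toHom φ.injective f = e := by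
  obtain ⟨a, ha⟩ := hs
  obtain ⟨b, hb⟩ := ht
  have hab : H.Adj a b := by
    rw [← φ.map_adj_iff, ha, hb]
    exact e.adj
  have hlt : φ a < φ b := by rw [ha, hb]; exact e.lt
  rcases lt_or_gt_of_ne hab.ne with h | h
  · refine ⟨⟨a, b, h, hab⟩, ?_⟩
    refine (dif_pos hlt).trans ?_
    exact Edge.ext ha hb
  · refine ⟨⟨b, a, h, hab.symm⟩, ?_⟩
    refine (dif_neg hlt.not_gt).trans ?_
    exact Edge.ext ha hb

/-- A monomial supported on the image involves only edges with both endpoints there, and these all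
come from `H` because the embedding reflects adjacency. -/
theorem map_subcomplex (φ : H ↪g G) (k : ℕ) :
    (subcomplex H Set.univ k).map (cochainMap φ.toHom φ.injective).toLinearMap =
      subcomplex G (Set.range φ) k := by
  refine le_antisymm (map_subcomplex_le _ _ k) ?_
  rw [subcomplex, Submodule.span_le]
  rintro _ ⟨hS, p, q, hk, hpq, rfl⟩
  obtain ⟨p, rfl⟩ : ∃ p', p = List.map φ p' := by
    have : p ∈ Set.range (List.map φ) := by
      rw [Set.range_list_map]
      exact fun v hv => hpq ▸ Or.inl hv
    obtain ⟨p', h⟩ := this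
    exact ⟨p', h.symm⟩
  obtain ⟨q, rfl⟩ : ∃ q', q = List.map (edgeMap φ.toHom φ.injective) q' := by
    have : q ∈ Set.range (List.map (edgeMap φ.toHom φ.injective)) := by
      rw [Set.range_list_map]
      exact fun e he => exists_edgeMap_eq φ (hpq ▸ Or.inr ⟨e, he, Or.inl rfl⟩)
        (hpq ▸ Or.inr ⟨e, he, Or.inr rfl⟩)
    obtain ⟨q', h⟩ := this
    exact ⟨q', h.symm⟩
  obtain ⟨c, hc, h⟩ := cochainMap_prod φ.toHom φ.injective p q
  -- The inverse scalar compensates the product of edge signs picked up by the monomial.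
  refine ⟨c⁻¹ • ((p.map (xv H)).prod * (q.map (xe H)).prod), Submodule.smul_mem _ _ ?_, ?_⟩
  · refine Submodule.subset_span ⟨Set.range_nonempty_iff_nonempty.1 hS |>.elim fun w => ⟨w, trivial⟩,
      p, q, by simpa using hk, ?_, rfl⟩
    symm
    rw [Set.eq_univ_iff_forall]
    intro w
    have hw : φ w ∈ Set.range φ := ⟨w, rfl⟩
    rw [hpq] at hw
    simp only [List.mem_map, Set.mem_ofPred_eq, exists_exists_and_eq_and, mem_edgeMap_iff] at hw
    rcases hw with ⟨w', hw', h⟩ | ⟨e, he, h⟩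
    · exact Or.inl (φ.injective h ▸ hw')
    · exact Or.inr ⟨e, he, h.imp (fun h => φ.injective h) (fun h => φ.injective h)⟩
  · rw [map_smul, AlgHom.toLinearMap_apply, h, inv_smul_smul₀ hc]
    rfl

variable [Finite W] [Finite V]

theorem finrank_cohomology_range (φ : H ↪g G) (k : ℕ) :
    finrank ℝ (Cohomology G (subcomplex G (Set.range φ)) k) = essentialBetti H k := by
  set Φ := (cochainMap φ.toHom φ.injective).toLinearMap
  have hinj : Function.Injective Φ := cochainMap_injective φ.toHom φ.injective
  have hd (a) : differential G (Φ a) = Φ (differential H a) := differential_cochainMap _ _ a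
  have h₁ : (cocycles H (subcomplex H Set.univ) k).map Φ =
      cocycles G (subcomplex G (Set.range φ)) k := by
    rw [cocycles, cocycles, ← map_subcomplex]
    ext x
    constructor
    · rintro ⟨a, ⟨ha, ha'⟩, rfl⟩
      refine ⟨⟨a, ha, rfl⟩, ?_⟩
      exact (hd a).trans ((congrArg Φ ha').trans (map_zero Φ))
    · rintro ⟨⟨a, ha, rfl⟩, ha'⟩
      refine ⟨a, ⟨ha, ?_⟩, rfl⟩
      apply hinj
      rw [map_zero, ← hd]
      exact ha'
  have h₂ : (coboundaries H (subcomplex H Set.univ) k).map Φ =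
      coboundaries G (subcomplex G (Set.range φ)) k := by
    cases k with
    | zero => exact Submodule.map_bot _
    | succ k =>
      rw [coboundaries, coboundaries, ← map_subcomplex, ← Submodule.map_comp, ← Submodule.map_comp]
      exact congrArg (Submodule.map · _) (LinearMap.ext fun a => (hd a).symm)
  have h₃ := finrank_cohomology G _ (differential_mem_subcomplex G (Set.range φ)) k
  have h₄ : essentialBetti H k + _ = _ :=
    finrank_cohomology H _ (differential_mem_subcomplex H Set.univ) k
  have h₅ := (Submodule.equivMapOfInjective Φ hinj (cocycles H (subcomplex H Set.univ) k)).finrank_eq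
  have h₆ :=
    (Submodule.equivMapOfInjective Φ hinj (coboundaries H (subcomplex H Set.univ) k)).finrank_eq
  rw [h₁] at h₅
  rw [h₂] at h₆
  omega

/-- The isomorphism need not respect the vertex orders, so this also shows that the number does not
depend on the chosen order. -/
theorem essentialBetti_congr (φ : H ≃g G) (k : ℕ) : essentialBetti H k = essentialBetti G k := by
  have h : Set.range φ.toEmbedding = Set.univ := φ.surjective.range_eq
  rw [← finrank_cohomology_range φ.toEmbedding k, h, essentialBetti]

theorem betti_eq_sum_induce {G : SimpleGraph V} [Fintype (Set V)] (k : ℕ) (hk : 2 ≤ k) :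
    betti G k = ∑ S : Set V, essentialBetti (G.induce S) k := by
  rw [betti_eq_sum G k hk]
  refine Finset.sum_congr rfl fun S _ => ?_
  rw [← finrank_cohomology_range (SimpleGraph.Embedding.induce S) k]
  have : Set.range (SimpleGraph.Embedding.induce (G := G) S) = S := Subtype.range_coe
  rw [this]

end Embedding

/-! ## Sparse polynomials in skew-commuting variables

The variables are numbered; a monomial is the increasing list of its variables. -/

section SparsePolynomials

/-- Equality test for monomials. -/
def beqMono : List ℕ → List ℕ → Bool
  | [], [] => true
  | a :: s, b :: t => Nat.beq a b && beqMono s t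
  | _, _ => false

/-- The product of the variable `g` with a monomial, as a signed monomial. -/
def genMulMono (g : ℕ) : List ℕ → Option (ℤ × List ℕ)
  | [] => some (1, [g])
  | h :: t =>
    bif Nat.blt g h then some (1, g :: h :: t)
    else bif Nat.beq g h then none
    else match genMulMono g t with
      | none => none
      | some (c, t') => some (-c, h :: t')

/-- The product of the variable `g` with a polynomial. -/
def genMul (g : ℕ) : List (ℤ × List ℕ) → List (ℤ × List ℕ)
  | [] => []
  | (c, k) :: p => match genMulMono g k with
    | none => genMul g p
    | some (c', k') => (c * c', k') :: genMul g p

/-- The multiple of a polynomial by a scalar. -/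
def polySmul (c : ℤ) : List (ℤ × List ℕ) → List (ℤ × List ℕ)
  | [] => []
  | (c', k) :: p => (c * c', k) :: polySmul c p

/-- The coefficient of a monomial in a polynomial. -/
def polyCoeff (k : List ℕ) : List (ℤ × List ℕ) → ℤ
  | [] => 0
  | (c, k') :: p => bif beqMono k k' then c + polyCoeff k p else polyCoeff k p

/-- The sum of a term and a polynomial. -/
def addTerm (c : ℤ) (k : List ℕ) : List (ℤ × List ℕ) → List (ℤ × List ℕ)
  | [] => [(c, k)]
  | (c', k') :: p =>
    bif beqMono k k' then
      (match c + c' with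
      | Int.ofNat 0 => p
      | s => (s, k) :: p)
    else (c', k') :: addTerm c k p

/-- The sum of two polynomials. -/
def polyAdd : List (ℤ × List ℕ) → List (ℤ × List ℕ) → List (ℤ × List ℕ)
  | [], q => q
  | (c, k) :: p, q => polyAdd p (addTerm c k q)

/-- The elimination of the monomial `k` from `s` by means of `r`, in which it has the coefficient
`a`. -/
def elimRow (k : List ℕ) (a : ℤ) (r s : List (ℤ × List ℕ)) : List (ℤ × List ℕ) :=
  match polyCoeff k s with
  | Int.ofNat 0 => s
  | b => polyAdd (polySmul (-b) r) (polySmul a s)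

/-- The rank of a list of polynomials by Gaussian elimination in at most `f` steps. -/
def rowRank : ℕ → List (List (ℤ × List ℕ)) → Option ℕ
  | _, [] => some 0
  | 0, _ :: _ => none
  | f + 1, [] :: rs => rowRank f rs
  | f + 1, ((c, k) :: r) :: rs =>
    -- The pivot coefficient is collected from the whole row, because a monomial may occur in
    -- several terms; if they cancel, no rank is reported.
    match polyCoeff k ((c, k) :: r) with
    | Int.ofNat 0 => none
    | a => (rowRank f (rs.map (elimRow k a ((c, k) :: r)))).map (· + 1)

/-- A polynomial as a vector in the space with the monomials as a basis. -/
noncomputable def toFinsupp : List (ℤ × List ℕ) → List ℕ →₀ ℝ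
  | [] => 0
  | (c, k) :: p => Finsupp.single k (c : ℝ) + toFinsupp p

theorem beqMono_iff (s t : List ℕ) : beqMono s t = true ↔ s = t := by
  induction s generalizing t with
  | nil => cases t <;> simp [beqMono]
  | cons a s ih => cases t <;> simp [beqMono, ih]

theorem beqMono_eq (s t : List ℕ) : beqMono s t = decide (s = t) := by
  rw [Bool.eq_iff_iff, beqMono_iff, decide_eq_true_iff]

theorem toFinsupp_polySmul (c : ℤ) (p : List (ℤ × List ℕ)) :
    toFinsupp (polySmul c p) = (c : ℝ) • toFinsupp p := by
  induction p with
  | nil => simp [polySmul, toFinsupp]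
  | cons t p ih => simp [polySmul, toFinsupp, ih]

theorem toFinsupp_append (p q : List (ℤ × List ℕ)) :
    toFinsupp (p ++ q) = toFinsupp p + toFinsupp q := by
  induction p with
  | nil => simp [toFinsupp]
  | cons t p ih => simp [toFinsupp, ih, add_assoc]

theorem polyCoeff_eq (k : List ℕ) (p : List (ℤ × List ℕ)) :
    (polyCoeff k p : ℝ) = toFinsupp p k := by
  induction p with
  | nil => simp [polyCoeff, toFinsupp]
  | cons t p ih =>
    by_cases h : k = t.2
    · subst h
      simp [polyCoeff, toFinsupp, beqMono_eq, ih]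
    · simp [polyCoeff, toFinsupp, beqMono_eq, h, ← ih]

theorem toFinsupp_addTerm (c : ℤ) (k : List ℕ) (p : List (ℤ × List ℕ)) :
    toFinsupp (addTerm c k p) = Finsupp.single k (c : ℝ) + toFinsupp p := by
  induction p with
  | nil => simp [addTerm, toFinsupp]
  | cons t p ih =>
    obtain ⟨c', k'⟩ := t
    by_cases h : k = k'
    · subst h
      simp only [addTerm, beqMono_eq, decide_true, cond_true, toFinsupp]
      rw [← add_assoc, ← Finsupp.single_add, ← Int.cast_add]
      split
      · rename_i h
        simp [h]
      · rfl
    · simp [addTerm, beqMono_eq, h, toFinsupp, ih, add_left_comm]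

theorem toFinsupp_polyAdd (p q : List (ℤ × List ℕ)) :
    toFinsupp (polyAdd p q) = toFinsupp p + toFinsupp q := by
  induction p generalizing q with
  | nil => simp [polyAdd, toFinsupp]
  | cons t p ih =>
    rw [polyAdd, ih, toFinsupp_addTerm, toFinsupp]
    abel

theorem toFinsupp_elimRow (k : List ℕ) (a : ℤ) (r s : List (ℤ × List ℕ)) :
    toFinsupp (elimRow k a r s) = toFinsupp s ∧ toFinsupp s k = 0 ∨
      toFinsupp (elimRow k a r s) = (a : ℝ) • toFinsupp s - toFinsupp s k • toFinsupp r := by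
  unfold elimRow
  split
  · rename_i h
    exact Or.inl ⟨rfl, by rw [← polyCoeff_eq, h]; simp⟩
  · right
    rw [toFinsupp_polyAdd, toFinsupp_polySmul, toFinsupp_polySmul, ← polyCoeff_eq]
    push_cast
    rw [neg_smul, neg_add_eq_sub]

/-- The space spanned by a list of polynomials. -/
noncomputable def rowSpan (rs : List (List (ℤ × List ℕ))) : Submodule ℝ (List ℕ →₀ ℝ) :=
  Submodule.span ℝ {x | ∃ r ∈ rs, toFinsupp r = x}

theorem rowSpan_nil : rowSpan [] = ⊥ := by
  rw [rowSpan, Submodule.span_eq_bot]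
  rintro _ ⟨_, h, _⟩
  cases h

theorem rowSpan_cons (r : List (ℤ × List ℕ)) (rs : List (List (ℤ × List ℕ))) :
    rowSpan (r :: rs) = Submodule.span ℝ {toFinsupp r} ⊔ rowSpan rs := by
  rw [rowSpan, rowSpan, ← Submodule.span_union]
  congr 1
  ext x
  simp [eq_comm]

instance (rs : List (List (ℤ × List ℕ))) : FiniteDimensional ℝ (rowSpan rs) := by
  induction rs with
  | nil =>
    rw [rowSpan_nil]
    infer_instance
  | cons r rs ih =>
    rw [rowSpan_cons]
    infer_instance

/-- A row operation replaces `s` by `a • s` minus a multiple of `r`, which is invertible over `ℝ` as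
`a ≠ 0`. -/
theorem span_sup_rowSpan_elimRow (k : List ℕ) (a : ℤ) (ha : a ≠ 0) (r : List (ℤ × List ℕ))
    (rs : List (List (ℤ × List ℕ))) :
    Submodule.span ℝ {toFinsupp r} ⊔ rowSpan (rs.map (elimRow k a r)) = rowSpan (r :: rs) := by
  have ha' : (a : ℝ) ≠ 0 := Int.cast_ne_zero.2 ha
  have hr (N : Submodule ℝ (List ℕ →₀ ℝ)) :
      toFinsupp r ∈ Submodule.span ℝ {toFinsupp r} ⊔ N :=
    Submodule.mem_sup_left (Submodule.mem_span_singleton_self _)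
  rw [rowSpan_cons]
  apply le_antisymm <;> refine sup_le le_sup_left (Submodule.span_le.2 ?_)
  · rintro _ ⟨_, h, rfl⟩
    obtain ⟨s, hs, rfl⟩ := List.mem_map.1 h
    have hs' : toFinsupp s ∈ Submodule.span ℝ {toFinsupp r} ⊔ rowSpan rs :=
      Submodule.mem_sup_right (Submodule.subset_span ⟨s, hs, rfl⟩)
    rcases toFinsupp_elimRow k a r s with ⟨h, -⟩ | h <;> rw [SetLike.mem_coe, h]
    · exact hs'
    · exact Submodule.sub_mem _ (Submodule.smul_mem _ _ hs') (Submodule.smul_mem _ _ (hr _))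
  · rintro _ ⟨s, hs, rfl⟩
    have hs' : toFinsupp (elimRow k a r s) ∈
        Submodule.span ℝ {toFinsupp r} ⊔ rowSpan (rs.map (elimRow k a r)) :=
      Submodule.mem_sup_right (Submodule.subset_span ⟨_, List.mem_map_of_mem hs, rfl⟩)
    rcases toFinsupp_elimRow k a r s with ⟨h, -⟩ | h <;> rw [h] at hs'
    · exact hs'
    · have := Submodule.smul_mem _ (a : ℝ)⁻¹
        (Submodule.add_mem _ hs' (Submodule.smul_mem _ (toFinsupp s k) (hr _)))
      rwa [sub_add_cancel, inv_smul_smul₀ ha'] at this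

theorem rowSpan_elimRow_le_ker (k : List ℕ) (r : List (ℤ × List ℕ))
    (rs : List (List (ℤ × List ℕ))) :
    rowSpan (rs.map (elimRow k (polyCoeff k r) r)) ≤ LinearMap.ker (Finsupp.lapply (R := ℝ) k) := by
  refine Submodule.span_le.2 ?_
  rintro _ ⟨_, h, rfl⟩
  obtain ⟨s, hs, rfl⟩ := List.mem_map.1 h
  rw [SetLike.mem_coe, LinearMap.mem_ker, Finsupp.lapply_apply]
  rcases toFinsupp_elimRow k (polyCoeff k r) r s with ⟨h, h'⟩ | h <;> rw [h]
  · exact h'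
  · rw [polyCoeff_eq]
    simp [mul_comm]

/-- After elimination all other rows have coefficient zero at the pivot monomial while `r` does not,
so the line through `r` meets their span only in zero. -/
theorem finrank_rowSpan_cons (k : List ℕ) (r : List (ℤ × List ℕ)) (hr : polyCoeff k r ≠ 0)
    (rs : List (List (ℤ × List ℕ))) :
    Module.finrank ℝ (rowSpan (r :: rs)) =
      Module.finrank ℝ (rowSpan (rs.map (elimRow k (polyCoeff k r) r))) + 1 := by
  have hr' : toFinsupp r k ≠ 0 := by
    rw [← polyCoeff_eq]
    exact Int.cast_ne_zero.2 hr
  have hd : Disjoint (Submodule.span ℝ {toFinsupp r})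
      (rowSpan (rs.map (elimRow k (polyCoeff k r) r))) := by
    rw [Submodule.disjoint_def]
    intro x hx hx'
    obtain ⟨c, rfl⟩ := Submodule.mem_span_singleton.1 hx
    have h := LinearMap.mem_ker.1 (rowSpan_elimRow_le_ker k r rs hx')
    simp only [Finsupp.lapply_apply, Finsupp.smul_apply, smul_eq_mul, mul_eq_zero, hr', or_false]
      at h
    rw [h, zero_smul]
  have h := Submodule.finrank_sup_add_finrank_inf_eq (Submodule.span ℝ {toFinsupp r})
    (rowSpan (rs.map (elimRow k (polyCoeff k r) r)))
  rwa [hd.eq_bot, finrank_bot, add_zero, span_sup_rowSpan_elimRow k _ hr,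
    finrank_span_singleton fun h => hr' (by rw [h]; rfl), add_comm 1] at h

theorem finrank_rowSpan (f : ℕ) (rs : List (List (ℤ × List ℕ))) (m : ℕ)
    (h : rowRank f rs = some m) : Module.finrank ℝ (rowSpan rs) = m := by
  induction f generalizing rs m with
  | zero =>
    cases rs with
    | nil =>
      obtain rfl : 0 = m := by simpa [rowRank] using h
      rw [rowSpan_nil, finrank_bot]
    | cons r rs => simp [rowRank] at h
  | succ f ih =>
    rcases rs with _ | ⟨_ | ⟨⟨c, k⟩, r⟩, rs⟩
    · obtain rfl : 0 = m := by simpa [rowRank] using h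
      rw [rowSpan_nil, finrank_bot]
    · rw [rowRank] at h
      rw [rowSpan_cons, toFinsupp, Submodule.span_zero_singleton, bot_sup_eq]
      exact ih _ _ h
    · rw [rowRank] at h
      split at h
      · simp at h
      · rename_i h0
        obtain ⟨m', hm', rfl⟩ := Option.map_eq_some_iff.1 h
        rw [finrank_rowSpan_cons k _ h0, ih _ _ hm']

end SparsePolynomials

/-! ### The differential on sparse polynomials -/

section SparseDifferential

/-- The Chevalley-Eilenberg differential of a monomial. The variables below `10` are the vertices,
and the variable `10 * (i + 1) + j` is the edge `{i, j}`. -/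
def polyDiff : List ℕ → List (ℤ × List ℕ)
  | [] => []
  | g :: t =>
    bif Nat.blt g 10 then polySmul (-1) (genMul g (polyDiff t))
    else genMul (g / 10 - 1) (genMul (g % 10) [(1, t)]) ++ polySmul (-1) (genMul g (polyDiff t))

variable {A : Type*} [Ring A] [Algebra ℝ A]

/-- The value of a polynomial under a substitution of the variables. -/
noncomputable def polyEval (γ : ℕ → A) : (List ℕ →₀ ℝ) →ₗ[ℝ] A :=
  Finsupp.linearCombination ℝ fun k => (k.map γ).prod

variable {γ : ℕ → A}

theorem polyEval_single (k : List ℕ) (c : ℝ) :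
    polyEval γ (Finsupp.single k c) = c • (k.map γ).prod := Finsupp.linearCombination_single ..

theorem genMulMono_eval (hsq : ∀ g, γ g * γ g = 0) (hsw : ∀ g h, γ g * γ h = -(γ h * γ g))
    (g : ℕ) (k : List ℕ) : γ g * (k.map γ).prod =
      (genMulMono g k).elim 0 fun t => (t.1 : ℝ) • (t.2.map γ).prod := by
  induction k with
  | nil => simp [genMulMono]
  | cons h t ih =>
    rw [genMulMono]
    cases hlt : Nat.blt g h
    · cases heq : Nat.beq g h
      · have hmul : γ g * ((h :: t).map γ).prod = -(γ h * (γ g * (t.map γ).prod)) := by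
          rw [List.map_cons, List.prod_cons, ← mul_assoc, hsw g h, neg_mul, mul_assoc]
        rw [hmul, ih]
        rcases genMulMono g t with _ | ⟨c, t'⟩ <;> simp
      · obtain rfl := Nat.eq_of_beq_eq_true heq
        simp [← mul_assoc, hsq]
    · simp

theorem polyEval_genMul (hsq : ∀ g, γ g * γ g = 0) (hsw : ∀ g h, γ g * γ h = -(γ h * γ g))
    (g : ℕ) (p : List (ℤ × List ℕ)) :
    polyEval γ (toFinsupp (genMul g p)) = γ g * polyEval γ (toFinsupp p) := by
  induction p with
  | nil => simp [genMul, toFinsupp]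
  | cons t p ih =>
    obtain ⟨c, k⟩ := t
    rw [genMul, toFinsupp, map_add, mul_add, ← ih, polyEval_single, mul_smul_comm,
      genMulMono_eval hsq hsw]
    rcases genMulMono g k with _ | ⟨c', k'⟩
    · simp
    · simp only [Option.elim_some, toFinsupp, map_add, polyEval_single, smul_smul, Int.cast_mul]

/-- The Leibniz rule is assumed only for the variables in `k`, since numbers that encode no
generator of the graph have no reason to satisfy it. -/
theorem polyEval_polyDiff (hsq : ∀ g, γ g * γ g = 0) (hsw : ∀ g h, γ g * γ h = -(γ h * γ g))
    (d : A →ₗ[ℝ] A) (h1 : d 1 = 0) (k : List ℕ)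
    (hv : ∀ g ∈ k, g < 10 → ∀ a, d (γ g * a) = -(γ g * d a))
    (he : ∀ g ∈ k, ¬ g < 10 → ∀ a,
      d (γ g * a) = γ (g / 10 - 1) * (γ (g % 10) * a) - γ g * d a) :
    polyEval γ (toFinsupp (polyDiff k)) = d (k.map γ).prod := by
  induction k with
  | nil => simp [polyDiff, toFinsupp, h1]
  | cons g t ih =>
    rw [List.map_cons, List.prod_cons, polyDiff]
    have ih := ih (fun g hg => hv g (List.mem_cons_of_mem _ hg))
      (fun g hg => he g (List.mem_cons_of_mem _ hg))
    by_cases hg : g < 10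
    · have hb : Nat.blt g 10 = true := Nat.blt_eq ▸ hg
      rw [hb, cond_true, toFinsupp_polySmul, map_smul, polyEval_genMul hsq hsw, ih,
        hv g List.mem_cons_self hg]
      simp
    · have hb : Nat.blt g 10 = false := by
        rw [← Bool.not_eq_true, Nat.blt_eq]
        exact hg
      rw [hb, cond_false, toFinsupp_append, map_add, toFinsupp_polySmul, map_smul,
        polyEval_genMul hsq hsw, polyEval_genMul hsq hsw, polyEval_genMul hsq hsw, ih,
        he g List.mem_cons_self hg]
      simp [toFinsupp, polyEval_single, sub_eq_add_neg]

/-- The increasing lists of elements of `X`. -/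
def IsMono (X : Set ℕ) (k : List ℕ) : Prop := k.Pairwise (· < ·) ∧ ∀ g ∈ k, g ∈ X

theorem IsMono.genMulMono {X : Set ℕ} {g : ℕ} (hg : g ∈ X) {k : List ℕ} (hk : IsMono X k)
    {c : ℤ} {k' : List ℕ} (h : genMulMono g k = some (c, k')) :
    IsMono X k' ∧ ∀ x ∈ k', x = g ∨ x ∈ k := by
  induction k generalizing c k' with
  | nil =>
    obtain ⟨-, rfl⟩ : 1 = c ∧ [g] = k' := by simpa [DaniMainkar.genMulMono] using h
    simp [IsMono, hg]
  | cons a t ih =>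
    obtain ⟨hs, hX⟩ := hk
    rw [List.pairwise_cons] at hs
    rw [DaniMainkar.genMulMono] at h
    cases hlt : Nat.blt g a
    · cases heq : Nat.beq g a
      · rw [hlt, heq, cond_false, cond_false] at h
        have hag : a < g := by
          refine lt_of_le_of_ne ?_ (Ne.symm (Nat.ne_of_beq_eq_false heq))
          rw [← not_lt, ← Nat.blt_eq, hlt]
          exact Bool.false_ne_true
        cases hm : DaniMainkar.genMulMono g t with
        | none => simp [hm] at h
        | some q =>
          obtain ⟨c', t'⟩ := q
          obtain ⟨-, rfl⟩ : -c' = c ∧ a :: t' = k' := by simpa [hm] using h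
          obtain ⟨h₁, h₂⟩ := ih ⟨hs.2, fun x hx => hX x (List.mem_cons_of_mem _ hx)⟩ hm
          refine ⟨⟨List.pairwise_cons.2 ⟨fun x hx => ?_, h₁.1⟩, fun x hx => ?_⟩, fun x hx => ?_⟩
          · rcases h₂ x hx with rfl | hx
            exacts [hag, hs.1 x hx]
          · rcases List.mem_cons.1 hx with rfl | hx
            exacts [hX _ List.mem_cons_self, h₁.2 x hx]
          · rcases List.mem_cons.1 hx with rfl | hx
            · exact Or.inr List.mem_cons_self
            · exact (h₂ x hx).imp_right (List.mem_cons_of_mem _)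
      · simp [hlt, heq] at h
    · obtain ⟨-, rfl⟩ : 1 = c ∧ g :: a :: t = k' := by simpa [hlt] using h
      have hga : g < a := Nat.blt_eq ▸ hlt
      refine ⟨⟨?_, fun x hx => ?_⟩, fun x hx => List.mem_cons.1 hx⟩
      · refine List.pairwise_cons.2 ⟨fun x hx => ?_, List.pairwise_cons.2 hs⟩
        rcases List.mem_cons.1 hx with rfl | hx
        exacts [hga, hga.trans (hs.1 x hx)]
      · rcases List.mem_cons.1 hx with rfl | hx
        exacts [hg, hX x hx]

theorem isMono_genMul {X : Set ℕ} {g : ℕ} (hg : g ∈ X) (p : List (ℤ × List ℕ))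
    (hp : ∀ t ∈ p, IsMono X t.2) : ∀ t ∈ genMul g p, IsMono X t.2 := by
  induction p with
  | nil => simp [genMul]
  | cons t p ih =>
    obtain ⟨c, k⟩ := t
    have ih := ih fun t ht => hp t (List.mem_cons_of_mem _ ht)
    rw [genMul]
    cases hm : genMulMono g k with
    | none => exact ih
    | some q =>
      intro t ht
      rcases List.mem_cons.1 ht with rfl | ht
      exacts [((hp _ List.mem_cons_self).genMulMono hg hm).1, ih t ht]

theorem isMono_polySmul {X : Set ℕ} (c : ℤ) (p : List (ℤ × List ℕ))
    (hp : ∀ t ∈ p, IsMono X t.2) : ∀ t ∈ polySmul c p, IsMono X t.2 := by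
  induction p with
  | nil => simp [polySmul]
  | cons t p ih =>
    intro t' ht'
    rcases List.mem_cons.1 ht' with rfl | ht'
    exacts [hp t List.mem_cons_self, ih (fun t ht => hp t (List.mem_cons_of_mem _ ht)) t' ht']

/-- Staying within increasing lists over `X` matters because only there are the evaluated monomials
linearly independent. The condition on `X` says that it contains the endpoints of its edges. -/
theorem isMono_polyDiff {X : Set ℕ} (hX : ∀ g ∈ X, ¬ g < 10 → g / 10 - 1 ∈ X ∧ g % 10 ∈ X)
    (k : List ℕ) (hk : IsMono X k) : ∀ t ∈ polyDiff k, IsMono X t.2 := by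
  induction k with
  | nil => simp [polyDiff]
  | cons g t ih =>
    have ht : IsMono X t :=
      ⟨(List.pairwise_cons.1 hk.1).2, fun x hx => hk.2 x (List.mem_cons_of_mem _ hx)⟩
    have hg := hk.2 g List.mem_cons_self
    have h := isMono_polySmul (-1) _ (isMono_genMul hg _ (ih ht))
    rw [polyDiff]
    by_cases hlt : g < 10
    · have hb : Nat.blt g 10 = true := Nat.blt_eq ▸ hlt
      rw [hb, cond_true]
      exact h
    · have hb : Nat.blt g 10 = false := by
        rw [← Bool.not_eq_true, Nat.blt_eq]
        exact hlt
      rw [hb, cond_false]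
      intro t' ht'
      rcases List.mem_append.1 ht' with ht' | ht'
      · refine isMono_genMul (hX g hg hlt).1 _ (isMono_genMul (hX g hg hlt).2 _ ?_) t' ht'
        simpa using ht
      · exact h t' ht'

theorem toFinsupp_mem_supported {X : Set ℕ} (p : List (ℤ × List ℕ))
    (hp : ∀ t ∈ p, IsMono X t.2) :
    toFinsupp p ∈ Finsupp.supported ℝ ℝ {k | IsMono X k} := by
  induction p with
  | nil => exact Submodule.zero_mem _
  | cons t p ih =>
    exact Submodule.add_mem _ (Finsupp.single_mem_supported _ _ (hp t List.mem_cons_self))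
      (ih fun t ht => hp t (List.mem_cons_of_mem _ ht))

end SparseDifferential

/-! ## Computation of the essential cohomology of small graphs -/

section SmallGraphs

open Module

/-- The pairs `(i, j)` with `i < j < n`. -/
def pairs (n : ℕ) : List (ℕ × ℕ) :=
  (List.range n).flatMap fun i => ((List.range n).filter fun j => Nat.blt i j).map fun j => (i, j)

theorem mem_pairs {n : ℕ} {p : ℕ × ℕ} : p ∈ pairs n ↔ p.1 < p.2 ∧ p.2 < n := by
  obtain ⟨i, j⟩ := p
  simp only [pairs, List.mem_flatMap, List.mem_map, List.mem_filter, List.mem_range, Nat.blt_eq,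
    Prod.mk.injEq]
  constructor
  · rintro ⟨_, -, _, ⟨h₁, h₂⟩, rfl, rfl⟩
    exact ⟨h₂, h₁⟩
  · rintro ⟨h₁, h₂⟩
    exact ⟨i, h₁.trans h₂, j, ⟨h₂, h₁⟩, rfl, rfl⟩

/-- The variables of the graph on `0, …, n - 1` with the edges `E`. -/
def gens (n : ℕ) (E : List (ℕ × ℕ)) : List ℕ :=
  List.range n ++ E.map fun e => 10 * (e.1 + 1) + e.2

/-- Whether the vertex `v` occurs in the variable `g`. -/
def genCovers (v g : ℕ) : Bool :=
  bif Nat.blt g 10 then Nat.beq g v else Nat.beq (g / 10) (v + 1) || Nat.beq (g % 10) v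

/-- Whether all vertices `0, …, n - 1` occur in a monomial. -/
def covers : ℕ → List ℕ → Bool
  | 0, _ => true
  | n + 1, k => k.any (genCovers n) && covers n k

/-- The monomials of degree `k` in which all vertices occur. -/
def essMonos (n : ℕ) (E : List (ℕ × ℕ)) (k : ℕ) : List (List ℕ) :=
  ((gens n E).sublistsLen k).filter (covers n)

/-- The rank of the differential on the essential cochains of degree `k`. -/
def essRank (n : ℕ) (E : List (ℕ × ℕ)) (k : ℕ) : Option ℕ :=
  -- The fuel exceeds the number of rows in every case evaluated; too little of it would give
  -- `none`, never a wrong rank.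
  rowRank 100 ((essMonos n E k).map polyDiff)

/-- The dimension of the third essential cohomology of the graph on `0, …, n - 1` with the
edges `E`. -/
def computeBetti (n : ℕ) (E : List (ℕ × ℕ)) : Option ℕ :=
  match essRank n E 3, essRank n E 2 with
  | some a, some b => some ((essMonos n E 3).length - a - b)
  | _, _ => none

theorem covers_iff {n : ℕ} {k : List ℕ} :
    covers n k = true ↔ ∀ v < n, ∃ g ∈ k, genCovers v g = true := by
  induction n with
  | zero => simp [covers]
  | succ n ih =>
    rw [covers, Bool.and_eq_true, List.any_eq_true, ih]
    constructor
    · rintro ⟨h₁, h₂⟩ v hv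
      rcases Nat.lt_succ_iff_lt_or_eq.1 hv with hv | rfl
      exacts [h₂ v hv, h₁]
    · exact fun h => ⟨h n n.lt_succ_self, fun v hv => h v (Nat.lt_succ_of_lt hv)⟩

/-- Checking complete graphs suffices: the variables of any other graph form a sublist, so they and
all monomials drawn from them are increasing. -/
theorem pairwise_gens_pairs : ∀ n ≤ 6, (gens n (pairs n)).Pairwise (· < ·) := by
  decide +kernel

variable {n : ℕ} {H : SimpleGraph (Fin n)}

/-- The number of a generator. -/
def genCode : Gen H → ℕ := Sum.elim (fun i => i) (fun e => 10 * (e.src + 1) + e.tgt)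

/-- The cochain of a variable. -/
noncomputable def codeGen : ℕ → Cochains H := Function.extend genCode gen fun _ => 0

/-- Numbers that encode nothing are sent to `0`, which is also in the image of `ι`; hence the
skew-commutation rules hold for all numbers. -/
theorem exists_codeGen_eq (g : ℕ) :
    ∃ ξ : Dual ℝ (LieAlg H), codeGen g = ExteriorAlgebra.ι ℝ ξ := by
  classical
  unfold codeGen Function.extend
  split_ifs with h
  exacts [⟨_, rfl⟩, ⟨0, (map_zero _).symm⟩]

theorem codeGen_mul_self (g : ℕ) : codeGen (H := H) g * codeGen g = 0 := by
  obtain ⟨ξ, h⟩ := exists_codeGen_eq (H := H) g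
  rw [h, ExteriorAlgebra.ι_sq_zero]

theorem codeGen_mul_swap (g h : ℕ) :
    codeGen (H := H) g * codeGen h = -(codeGen h * codeGen g) := by
  obtain ⟨ξ, h₁⟩ := exists_codeGen_eq (H := H) g
  obtain ⟨η, h₂⟩ := exists_codeGen_eq (H := H) h
  rw [h₁, h₂, ι_mul_ι_swap]

theorem genCode_injective (hn : n ≤ 6) : Function.Injective (genCode (H := H)) := by
  rintro (i | e) (j | f) h
  · exact congrArg Sum.inl (Fin.ext h)
  · have := i.2
    simp only [genCode, Sum.elim_inl, Sum.elim_inr] at h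
    omega
  · have := j.2
    simp only [genCode, Sum.elim_inl, Sum.elim_inr] at h
    omega
  · have := e.tgt.2
    have := f.tgt.2
    simp only [genCode, Sum.elim_inr] at h
    exact congrArg Sum.inr (Edge.ext (Fin.ext (by omega)) (Fin.ext (by omega)))

theorem codeGen_genCode (hn : n ≤ 6) (g : Gen H) : codeGen (genCode g) = gen g :=
  (genCode_injective hn).extend_apply _ _ _

theorem genCovers_genCode (hn : n ≤ 6) (v : Fin n) (g : Gen H) :
    genCovers v (genCode g) = true ↔ v ∈ g.supp := by
  rcases g with i | e
  · have hb : Nat.blt i 10 = true := Nat.blt_eq ▸ (by omega : (i : ℕ) < 10)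
    simp only [genCovers, genCode, Sum.elim_inl, hb, cond_true, Nat.beq_eq]
    exact ⟨fun h => (Fin.ext h).symm, fun h => congrArg Fin.val (Eq.symm h)⟩
  · have hb : Nat.blt (10 * (e.src + 1) + e.tgt) 10 = false := by
      rw [← Bool.not_eq_true, Nat.blt_eq]
      omega
    have h₁ : (10 * ((e.src : ℕ) + 1) + e.tgt) / 10 = e.src + 1 := by omega
    have h₂ : (10 * ((e.src : ℕ) + 1) + e.tgt) % 10 = e.tgt := by omega
    simp only [genCovers, genCode, Sum.elim_inr, hb, cond_false, h₁, h₂, Bool.or_eq_true,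
      Nat.beq_eq, Nat.add_right_cancel_iff]
    exact or_congr ⟨fun h => (Fin.ext h).symm, fun h => congrArg Fin.val (Eq.symm h)⟩
      ⟨fun h => (Fin.ext h).symm, fun h => congrArg Fin.val (Eq.symm h)⟩

theorem exists_map_genCode {k : List ℕ} (hk : ∀ x ∈ k, x ∈ Set.range (genCode (H := H))) :
    ∃ l : List (Gen H), l.map genCode = k := by
  have : k ∈ Set.range (List.map (genCode (H := H))) := by
    rw [Set.range_list_map]
    exact hk
  exact this

theorem prod_map_codeGen (hn : n ≤ 6) (l : List (Gen H)) :
    ((l.map genCode).map codeGen).prod = (l.map gen).prod := by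
  rw [List.map_map]
  congr 2
  ext1 g
  exact codeGen_genCode hn g

theorem polyEval_codeGen_polyDiff (hn : n ≤ 6) {k : List ℕ}
    (hk : ∀ x ∈ k, x ∈ Set.range (genCode (H := H))) :
    polyEval codeGen (toFinsupp (polyDiff k)) = differential H (k.map codeGen).prod := by
  refine polyEval_polyDiff codeGen_mul_self codeGen_mul_swap _ (differential_one H) k ?_ ?_
  · intro x hx hlt a
    obtain ⟨i | e, rfl⟩ := hk x hx
    · rw [codeGen_genCode hn]
      exact differential_xv_mul H i a
    · simp only [genCode, Sum.elim_inr] at hlt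
      omega
  · intro x hx hlt a
    obtain ⟨i | e, rfl⟩ := hk x hx
    · simp only [genCode, Sum.elim_inl] at hlt
      omega
    · have h₁ : genCode (Sum.inr e : Gen H) / 10 - 1 = genCode (Sum.inl e.src : Gen H) := by
        simp only [genCode, Sum.elim_inl, Sum.elim_inr]
        omega
      have h₂ : genCode (Sum.inr e : Gen H) % 10 = genCode (Sum.inl e.tgt : Gen H) := by
        simp only [genCode, Sum.elim_inl, Sum.elim_inr]
        omega
      rw [h₁, h₂, codeGen_genCode hn, codeGen_genCode hn, codeGen_genCode hn, ← mul_assoc]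
      exact differential_xe_mul H e a

/-- An increasing list is determined by its set of entries, so different lists give, up to sign,
different members of the monomial basis. -/
theorem linearIndepOn_prod_codeGen (hn : n ≤ 6) :
    LinearIndepOn ℝ (fun k : List ℕ => (k.map (codeGen (H := H))).prod)
      {k | IsMono (Set.range (genCode (H := H))) k} := by
  classical
  have key (k : {k | IsMono (Set.range (genCode (H := H))) k}) :
      ∃ (c : ℝˣ) (s : Finset (Gen H)), (∀ g, g ∈ s ↔ genCode g ∈ k.1) ∧
        (k.1.map (codeGen (H := H))).prod = c • cochainBasis H s := by
    obtain ⟨k, hs, hk⟩ := k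
    obtain ⟨l, rfl⟩ := exists_map_genCode hk
    have hl : (l.map genCode).Nodup := hs.imp fun h => h.ne
    replace hl := hl.of_map
    have hmem (g) : g ∈ l.toFinset ↔ genCode g ∈ l.map genCode := by
      rw [List.mem_toFinset, List.mem_map_of_injective (genCode_injective hn)]
    rcases gen_prod_eq hl (s := l.toFinset) (fun g => List.mem_toFinset.symm) with h | h
    · exact ⟨1, _, hmem, by rw [prod_map_codeGen hn, h, one_smul]⟩
    · exact ⟨-1, _, hmem, by rw [prod_map_codeGen hn, h, Units.smul_def]; simp⟩
  choose c s hs hc using key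
  have hinj : Function.Injective s := by
    intro k k' h
    refine Subtype.ext (List.Pairwise.eq_of_mem_iff k.2.1 k'.2.1 fun x => ?_)
    constructor
    · intro hx
      obtain ⟨g, rfl⟩ := k.2.2 x hx
      rwa [← hs, ← h, hs]
    · intro hx
      obtain ⟨g, rfl⟩ := k'.2.2 x hx
      rwa [← hs, h, hs]
  have := ((cochainBasis H).linearIndependent.comp s hinj).units_smul c
  rw [LinearIndepOn]
  convert this using 1
  ext1 k
  exact hc k

/-- This transfers ranks computed with formal lists to ranks in the exterior algebra. -/
theorem finrank_map_polyEval (hn : n ≤ 6) {N : Submodule ℝ (List ℕ →₀ ℝ)}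
    (hN : N ≤ Finsupp.supported ℝ ℝ {k | IsMono (Set.range (genCode (H := H))) k}) :
    finrank ℝ (N.map (polyEval (codeGen (H := H)))) = finrank ℝ N := by
  have h := (linearIndepOn_iff_disjoint.1 (linearIndepOn_prod_codeGen (H := H) hn)).mono_left hN
  have hinj : Function.Injective ((polyEval (codeGen (H := H))).domRestrict N) := by
    refine (injective_iff_map_eq_zero _).2 ?_
    rintro ⟨x, hx⟩ hx'
    exact Subtype.ext (Submodule.disjoint_def.1 h x hx hx')
  rw [← LinearMap.range_domRestrict]
  exact LinearMap.finrank_range_of_inj hinj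

variable {E : List (ℕ × ℕ)}

theorem mem_gens_iff (hE : E.Sublist (pairs n))
    (hadj : ∀ i j : Fin n, i < j → (H.Adj i j ↔ ((i : ℕ), (j : ℕ)) ∈ E)) {x : ℕ} :
    x ∈ gens n E ↔ x ∈ Set.range (genCode (H := H)) := by
  simp only [gens, List.mem_append, List.mem_range, List.mem_map, Set.mem_range, Sum.exists]
  refine or_congr ⟨fun h => ⟨⟨x, h⟩, rfl⟩, ?_⟩ ⟨?_, ?_⟩
  · rintro ⟨i, rfl⟩
    exact i.2
  · rintro ⟨⟨i, j⟩, h, rfl⟩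
    obtain ⟨h₁, h₂⟩ := mem_pairs.1 (hE.mem h)
    exact ⟨⟨⟨i, h₁.trans h₂⟩, ⟨j, h₂⟩, h₁, (hadj _ _ h₁).2 h⟩, rfl⟩
  · rintro ⟨e, rfl⟩
    exact ⟨(e.src, e.tgt), (hadj _ _ e.lt).1 e.adj, rfl⟩

theorem isMono_of_mem_essMonos (hn : n ≤ 6) (hE : E.Sublist (pairs n))
    (hadj : ∀ i j : Fin n, i < j → (H.Adj i j ↔ ((i : ℕ), (j : ℕ)) ∈ E)) {d : ℕ} {k : List ℕ}
    (hk : k ∈ essMonos n E d) : IsMono (Set.range (genCode (H := H))) k := by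
  have hsub := (List.mem_sublistsLen.1 (List.mem_filter.1 hk).1).1
  refine ⟨((pairwise_gens_pairs n hn).sublist ?_).sublist hsub, fun x hx =>
    (mem_gens_iff hE hadj).1 (hsub.mem hx)⟩
  exact (List.Sublist.refl _).append (hE.map _)

/-- For `n = 0` the empty list would count as covering, whereas the subcomplex is zero by
convention; hence `h0`. -/
theorem subcomplex_univ_eq_span (hn : n ≤ 6) (h0 : n ≠ 0) (hE : E.Sublist (pairs n))
    (hadj : ∀ i j : Fin n, i < j → (H.Adj i j ↔ ((i : ℕ), (j : ℕ)) ∈ E)) (d : ℕ) :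
    subcomplex H Set.univ d = Submodule.span ℝ
      ((fun k : List ℕ => (k.map codeGen).prod) '' {k | k ∈ essMonos n E d}) := by
  classical
  rw [subcomplex_eq_span]
  have hcov (l : List (Gen H)) : covers n (l.map genCode) = true ↔
      Set.univ = {v | ∃ g ∈ l, v ∈ Gen.supp g} := by
    rw [covers_iff, eq_comm, Set.eq_univ_iff_forall]
    simp only [List.mem_map, exists_exists_and_eq_and, Set.mem_ofPred_eq, ← genCovers_genCode hn]
    exact ⟨fun h v => h v v.2, fun h v hv => h ⟨v, hv⟩⟩
  apply le_antisymm <;> rw [Submodule.span_le]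
  · rintro _ ⟨s, ⟨rfl, -, hs⟩, rfl⟩
    -- Filtering the list of all variables enumerates `s` as a sublist of it, the form in which
    -- `essMonos` lists its monomials.
    set k := (gens n E).filter fun x => ∃ g ∈ s, genCode g = x with hk
    have hmem (g : Gen H) : genCode g ∈ k ↔ g ∈ s := by
      rw [hk, List.mem_filter, mem_gens_iff hE hadj, decide_eq_true_iff]
      constructor
      · rintro ⟨-, g', hg', h⟩
        exact genCode_injective hn h ▸ hg'
      · exact fun h => ⟨⟨g, rfl⟩, g, h, rfl⟩
    have hsub : k.Sublist (gens n E) := List.filter_sublist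
    have hnd : k.Nodup := (((pairwise_gens_pairs n hn).sublist
      ((List.Sublist.refl _).append (hE.map _))).sublist hsub).imp fun h => h.ne
    obtain ⟨l, hl⟩ := exists_map_genCode (H := H) (k := k) fun x hx =>
      (mem_gens_iff hE hadj).1 (hsub.mem hx)
    rw [← hl] at hmem hnd hsub
    have hmem' (g : Gen H) : g ∈ l ↔ g ∈ s := by
      rw [← hmem, List.mem_map_of_injective (genCode_injective hn)]
    have hperm : l.Perm s.toList :=
      (List.perm_ext_iff_of_nodup hnd.of_map s.nodup_toList).2 fun g => by
        rw [hmem', Finset.mem_toList]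
    refine cochainBasis_mem_of_prod_mem hnd.of_map hmem' (Submodule.subset_span
      ⟨l.map genCode, List.mem_filter.2 ⟨List.mem_sublistsLen.2 ⟨hsub, ?_⟩, ?_⟩,
        prod_map_codeGen hn l⟩)
    · rw [List.length_map, hperm.length_eq, Finset.length_toList]
    · rw [hcov, hs]
      simp only [hmem']
  · rintro _ ⟨k, hk, rfl⟩
    obtain ⟨l, rfl⟩ := exists_map_genCode (isMono_of_mem_essMonos hn hE hadj hk).2
    obtain ⟨h₁, h₂⟩ := List.mem_filter.1 hk
    have hlen := (List.mem_sublistsLen.1 h₁).2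
    dsimp only
    rw [SetLike.mem_coe, prod_map_codeGen hn]
    refine gen_prod_mem_span fun hnd => ⟨l.toFinset, ⟨?_, ⟨⟨0, Nat.pos_of_ne_zero h0⟩, trivial⟩, ?_⟩,
      fun g => List.mem_toFinset.symm⟩
    · rw [List.toFinset_card_of_nodup hnd, ← hlen, List.length_map]
    · rw [(hcov l).1 h₂]
      simp only [List.mem_toFinset]

theorem finrank_subcomplex_univ (hn : n ≤ 6) (h0 : n ≠ 0) (hE : E.Sublist (pairs n))
    (hadj : ∀ i j : Fin n, i < j → (H.Adj i j ↔ ((i : ℕ), (j : ℕ)) ∈ E)) (d : ℕ) :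
    finrank ℝ (subcomplex H Set.univ d) = (essMonos n E d).length := by
  classical
  have hnd : (essMonos n E d).Nodup := by
    refine List.Nodup.filter _ (List.nodup_sublistsLen d ?_)
    exact ((pairwise_gens_pairs n hn).sublist
      ((List.Sublist.refl _).append (hE.map _))).imp fun h => h.ne
  have hli : LinearIndepOn ℝ (fun k : List ℕ => (k.map (codeGen (H := H))).prod)
      {k | k ∈ essMonos n E d} :=
    (linearIndepOn_prod_codeGen hn).mono fun k hk => isMono_of_mem_essMonos hn hE hadj hk
  have hset : {k | k ∈ essMonos n E d} = ↑(essMonos n E d).toFinset := by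
    ext k
    simp
  rw [subcomplex_univ_eq_span hn h0 hE hadj]
  rw [hset] at hli ⊢
  rw [Set.image_eq_range]
  refine (finrank_span_eq_card hli).trans ?_
  rw [← List.toFinset_card_of_nodup hnd]
  exact Fintype.card_coe _

theorem finrank_map_differential (hn : n ≤ 6) (h0 : n ≠ 0) (hE : E.Sublist (pairs n))
    (hadj : ∀ i j : Fin n, i < j → (H.Adj i j ↔ ((i : ℕ), (j : ℕ)) ∈ E)) (d m : ℕ)
    (hm : essRank n E d = some m) :
    finrank ℝ ((subcomplex H Set.univ d).map (differential H)) = m := by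
  rw [← finrank_rowSpan _ _ m hm, ← finrank_map_polyEval (H := H) hn]
  · rw [subcomplex_univ_eq_span hn h0 hE hadj, rowSpan, Submodule.map_span, Submodule.map_span]
    refine congrArg (fun A => finrank ℝ (Submodule.span ℝ A)) ?_
    ext x
    simp only [Set.mem_image, Set.mem_ofPred_eq, List.mem_map, exists_exists_and_eq_and]
    refine exists_congr fun k => and_congr_right fun hk => ?_
    rw [polyEval_codeGen_polyDiff hn (isMono_of_mem_essMonos hn hE hadj hk).2]
  · refine Submodule.span_le.2 ?_
    rintro _ ⟨_, hr, rfl⟩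
    obtain ⟨k, hk, rfl⟩ := List.mem_map.1 hr
    refine toFinsupp_mem_supported _
      (isMono_polyDiff ?_ k (isMono_of_mem_essMonos hn hE hadj hk))
    rintro _ ⟨i | e, rfl⟩ hlt
    · simp only [genCode, Sum.elim_inl] at hlt
      omega
    · refine ⟨⟨Sum.inl e.src, ?_⟩, ⟨Sum.inl e.tgt, ?_⟩⟩ <;>
        simp only [genCode, Sum.elim_inl, Sum.elim_inr] <;> omega

theorem finrank_cocycles_add (C : ℕ → Submodule ℝ (Cochains H)) (d : ℕ) :
    finrank ℝ (cocycles H C d) + finrank ℝ ((C d).map (differential H)) = finrank ℝ (C d) := by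
  have h := LinearMap.finrank_range_add_finrank_ker ((differential H).domRestrict (C d))
  rw [LinearMap.range_domRestrict] at h
  have e := (Submodule.equivMapOfInjective (C d).subtype (C d).injective_subtype
    (LinearMap.ker ((differential H).domRestrict (C d)))).finrank_eq
  rw [LinearMap.ker_domRestrict, Submodule.map_comap_subtype] at e
  rw [LinearMap.ker_domRestrict, e, add_comm] at h
  exact h

/-- The dimension of `H^3` is that of the 3-cochains minus the ranks of the differential in degrees
3 and 2. The additive identities `h₁` and `h₂` show that the truncated subtractions lose nothing. -/
theorem essentialBetti_eq_of_computeBetti (hn : n ≤ 6) (h0 : n ≠ 0) (hE : E.Sublist (pairs n))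
    (hadj : ∀ i j : Fin n, i < j → (H.Adj i j ↔ ((i : ℕ), (j : ℕ)) ∈ E)) (m : ℕ)
    (hm : computeBetti n E = some m) : essentialBetti H 3 = m := by
  unfold computeBetti at hm
  split at hm
  · rename_i a b ha hb
    have h₁ := finrank_cocycles_add (subcomplex H Set.univ) 3
    rw [finrank_map_differential hn h0 hE hadj 3 a ha,
      finrank_subcomplex_univ hn h0 hE hadj] at h₁
    have h₂ : essentialBetti H 3 + _ = _ :=
      finrank_cohomology H _ (differential_mem_subcomplex H Set.univ) 3
    rw [coboundaries, finrank_map_differential hn h0 hE hadj 2 b hb] at h₂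
    have h₃ := Option.some.inj hm
    omega
  · simp at hm

end SmallGraphs

/-! ## Graphs with at most five vertices -/

section Classification

open Module

/-- The natural number whose binary digits are ones exactly at the listed positions. -/
def bitsOf : List ℕ → ℕ
  | [] => 0
  | k :: l => 2 ^ k ||| bitsOf l

theorem testBit_bitsOf (l : List ℕ) (k : ℕ) : (bitsOf l).testBit k = true ↔ k ∈ l := by
  induction l with
  | nil => simp [bitsOf]
  | cons a l ih =>
    rw [bitsOf, Nat.testBit_or, Bool.or_eq_true, ih, Nat.testBit_two_pow, List.mem_cons,
      decide_eq_true_iff, eq_comm]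

/-- A numbering of the unordered pairs of distinct natural numbers. -/
def pairIndex (i j : ℕ) : ℕ :=
  bif Nat.blt i j then j * (j - 1) / 2 + i else i * (i - 1) / 2 + j

/-- The set of the edges `E`, relabelled by the list `p`, as a natural number. -/
def edgeMask (p : List ℕ) (E : List (ℕ × ℕ)) : ℕ :=
  bitsOf (E.map fun e => pairIndex (p.getD e.1 0) (p.getD e.2 0))

/-- All relabellings of a list of graphs on `0, …, n - 1`. -/
def orbitMasks (n : ℕ) (L : List (List (ℕ × ℕ))) : List ℕ :=
  L.flatMap fun E => (List.range n).permutations'.map fun p => edgeMask p E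

/-- Those of the 23 graphs that have `n` vertices. -/
def essentialGraphs (n : ℕ) : List (List (ℕ × ℕ)) :=
  ((List.finRange 23).filter fun j => Nat.beq (graphOrder j) n).map graphEdges

/-- Representatives of the isomorphism classes of the other graphs with `n ≤ 5` vertices. -/
def acyclicGraphs : ℕ → List (List (ℕ × ℕ))
  | 1 => [[]]
  | 2 => [[]]
  | 4 => [[], [(0, 1)], [(0, 3), (1, 2)]]
  | 5 => [[], [(0, 1)], [(0, 1), (0, 2)], [(0, 1), (0, 2), (0, 3)],
      [(0, 1), (0, 2), (0, 3), (0, 4)], [(0, 1), (0, 2), (1, 2)], [(0, 3), (1, 2)],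
      [(0, 1), (0, 3), (1, 2)], [(0, 1), (0, 2), (0, 3), (1, 2)], [(0, 3), (0, 4), (1, 2)],
      [(0, 1), (0, 3), (0, 4), (1, 2)], [(0, 1), (0, 2), (0, 3), (0, 4), (1, 2)],
      [(0, 2), (0, 3), (1, 2), (1, 3)], [(0, 1), (0, 2), (0, 3), (1, 2), (1, 3)],
      [(0, 2), (0, 4), (1, 2), (1, 3)], [(0, 1), (0, 2), (0, 4), (1, 2), (1, 3)],
      [(0, 2), (0, 3), (0, 4), (1, 2), (1, 3)], [(0, 1), (0, 2), (0, 3), (0, 4), (1, 2), (1, 3)],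
      [(0, 1), (0, 2), (0, 3), (1, 2), (1, 3), (2, 3)], [(0, 4), (1, 2), (1, 3), (2, 3)],
      [(0, 1), (0, 4), (1, 2), (1, 3), (2, 3)], [(0, 1), (0, 2), (0, 4), (1, 2), (1, 3), (2, 3)],
      [(0, 1), (0, 2), (0, 3), (0, 4), (1, 2), (1, 3), (2, 3)],
      [(0, 1), (0, 2), (0, 3), (0, 4), (1, 4), (2, 3)]]
  | _ => []

/-- The edges `(i, j)` with `i < j < n` of the graph given by a list of edges. -/
def edgesOf (n : ℕ) (E : List (ℕ × ℕ)) : List (ℕ × ℕ) :=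
  (pairs n).filter fun p => E.contains p || E.contains p.swap

theorem computeBetti_graphEdges (j : Fin 23) :
    computeBetti (graphOrder j) (edgesOf (graphOrder j) (graphEdges j)) = some (weight j) := by
  revert j
  decide +kernel

/-- Here "acyclic" means vanishing third essential cohomology, not absence of cycles. -/
theorem computeBetti_acyclicGraphs : ∀ n ≤ 5, ∀ E ∈ acyclicGraphs n,
    computeBetti n (edgesOf n E) = some 0 := by
  decide +kernel

/-- A graph on `n` labelled vertices is a number below `2 ^ (n * (n - 1) / 2)`, one bit per possible
edge. The right-hand side has a one at each such number, so every labelled graph is a relabelling of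
a listed one. -/
theorem bitsOf_orbitMasks : ∀ n ≤ 5, n ≠ 0 →
    bitsOf (orbitMasks n (essentialGraphs n ++ acyclicGraphs n)) = 2 ^ 2 ^ (n * (n - 1) / 2) - 1 := by
  decide +kernel

theorem mem_pairs_of_mem_graphs : ∀ n ≤ 5, ∀ E ∈ essentialGraphs n ++ acyclicGraphs n, ∀ e ∈ E,
    e.1 ≠ e.2 ∧ e.1 < n ∧ e.2 < n := by
  decide +kernel

theorem pairIndex_lt : ∀ n ≤ 5, ∀ i < n, ∀ j < n, i ≠ j → pairIndex i j < n * (n - 1) / 2 := by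
  decide +kernel

theorem pairIndex_inj : ∀ a b c d : Fin 5, a ≠ b → c ≠ d →
    pairIndex a b = pairIndex c d → a = c ∧ b = d ∨ a = d ∧ b = c := by
  decide +kernel

theorem listGraph_adj {n : ℕ} {E : List (ℕ × ℕ)} {i j : Fin n} : (listGraph n E).Adj i j ↔
    i ≠ j ∧ (((i : ℕ), (j : ℕ)) ∈ E ∨ ((j : ℕ), (i : ℕ)) ∈ E) :=
  SimpleGraph.fromRel_adj ..

theorem essentialBetti_listGraph {n : ℕ} (hn : n ≤ 6) (h0 : n ≠ 0) (E : List (ℕ × ℕ)) (m : ℕ)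
    (h : computeBetti n (edgesOf n E) = some m) : essentialBetti (listGraph n E) 3 = m := by
  refine essentialBetti_eq_of_computeBetti hn h0 List.filter_sublist (fun i j hij => ?_) m h
  rw [listGraph_adj, List.mem_filter, mem_pairs, Bool.or_eq_true, List.contains_iff_mem,
    List.contains_iff_mem]
  exact and_congr_left' ⟨fun _ => ⟨hij, j.2⟩, fun _ => hij.ne⟩

theorem essentialBetti_graph (j : Fin 23) : essentialBetti (graph j) 3 = weight j := by
  have h : ∀ j : Fin 23, graphOrder j ≤ 6 ∧ graphOrder j ≠ 0 := by decide
  exact essentialBetti_listGraph (h j).1 (h j).2 _ _ (computeBetti_graphEdges j)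

theorem exists_edgeMask_eq {n : ℕ} (hn : n ≤ 5) (h0 : n ≠ 0) {c : ℕ}
    (hc : c < 2 ^ (n * (n - 1) / 2)) : ∃ E ∈ essentialGraphs n ++ acyclicGraphs n,
      ∃ p : List ℕ, p.Perm (List.range n) ∧ edgeMask p E = c := by
  have h : (bitsOf (orbitMasks n (essentialGraphs n ++ acyclicGraphs n))).testBit c = true := by
    rw [bitsOf_orbitMasks n hn h0, Nat.testBit_two_pow_sub_one]
    exact decide_eq_true hc
  rw [testBit_bitsOf, orbitMasks, List.mem_flatMap] at h
  obtain ⟨E, hE, h⟩ := h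
  obtain ⟨p, hp, h⟩ := List.mem_map.1 h
  exact ⟨E, hE, p, List.mem_permutations'.1 hp, h⟩

theorem exists_iso_listGraph {n : ℕ} (hn : n ≤ 5) (h0 : n ≠ 0) (H : SimpleGraph (Fin n)) :
    ∃ E ∈ essentialGraphs n ++ acyclicGraphs n, Nonempty (H ≃g listGraph n E) := by
  classical
  have hinj (a b c d : Fin n) (hab : a ≠ b) (hcd : c ≠ d)
      (h : pairIndex a b = pairIndex c d) : a = c ∧ b = d ∨ a = d ∧ b = c := by
    have hle := Fin.castLE_injective hn
    have := pairIndex_inj (a.castLE hn) (b.castLE hn) (c.castLE hn) (d.castLE hn)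
      (hle.ne hab) (hle.ne hcd) h
    simpa only [hle.eq_iff] using this
  -- The edge set of `H` as a bit mask; `hbit` reads it off from `H`, and `hbit'` from the
  -- relabelled list graph with the same mask.
  set c := bitsOf ((Finset.univ.filter fun e : Fin n × Fin n => H.Adj e.1 e.2).toList.map
    fun e => pairIndex e.1 e.2) with hc
  have hbit (k : ℕ) : c.testBit k = true ↔ ∃ a b, H.Adj a b ∧ pairIndex a b = k := by
    rw [hc, testBit_bitsOf]
    simp
  have hlt : c < 2 ^ (n * (n - 1) / 2) := by
    refine Nat.lt_pow_two_of_testBit _ fun k hk => ?_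
    rw [← Bool.not_eq_true, hbit]
    rintro ⟨a, b, hab, rfl⟩
    exact absurd (pairIndex_lt n hn a a.2 b b.2 (Fin.val_ne_of_ne hab.ne)) (not_lt.2 hk)
  obtain ⟨E, hE, p, hp, hpc⟩ := exists_edgeMask_eq hn h0 hlt
  have hlen : p.length = n := by rw [hp.length_eq, List.length_range]
  have hnd : p.Nodup := hp.nodup_iff.2 List.nodup_range
  let σ : Fin n → Fin n := fun i =>
    ⟨p[i]'(by rw [hlen]; exact i.2), List.mem_range.1 (hp.mem_iff.1 (List.getElem_mem _))⟩
  have hσ : Function.Injective σ := fun i j h =>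
    Fin.ext ((hnd.getElem_inj_iff).1 (congrArg Fin.val h))
  have hσp (i : Fin n) : p.getD i 0 = σ i := List.getD_eq_getElem ..
  have hbit' (k : ℕ) : c.testBit k = true ↔ ∃ a b : Fin n, ((a : ℕ), (b : ℕ)) ∈ E ∧ a ≠ b ∧
      pairIndex (σ a) (σ b) = k := by
    rw [← hpc, edgeMask, testBit_bitsOf, List.mem_map]
    constructor
    · rintro ⟨⟨a, b⟩, he, rfl⟩
      obtain ⟨h, ha, hb⟩ := mem_pairs_of_mem_graphs n hn E hE _ he
      refine ⟨⟨a, ha⟩, ⟨b, hb⟩, he, fun h' => h (congrArg Fin.val h'), ?_⟩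
      rw [← hσp, ← hσp]
    · rintro ⟨a, b, he, -, rfl⟩
      exact ⟨_, he, by rw [hσp, hσp]⟩
  refine ⟨E, hE, ⟨RelIso.symm ⟨Equiv.ofBijective σ (Finite.injective_iff_bijective.1 hσ), ?_⟩⟩⟩
  intro a b
  change H.Adj (σ a) (σ b) ↔ (listGraph n E).Adj a b
  rw [listGraph_adj]
  constructor
  · intro h
    refine ⟨fun h' => h.ne (congrArg σ h'), ?_⟩
    obtain ⟨x, y, hxy, hne, hk⟩ := (hbit' _).1 ((hbit _).2 ⟨_, _, h, rfl⟩)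
    rcases hinj _ _ _ _ (hσ.ne hne) h.ne hk with ⟨h₁, h₂⟩ | ⟨h₁, h₂⟩ <;>
      rw [← hσ h₁, ← hσ h₂]
    exacts [Or.inl hxy, Or.inr hxy]
  · rintro ⟨hne, h⟩
    obtain ⟨x, y, hxy, hk⟩ : ∃ x y, H.Adj x y ∧ pairIndex x y = pairIndex (σ a) (σ b) := by
      rcases h with h | h
      · exact (hbit _).1 ((hbit' _).2 ⟨a, b, h, hne, rfl⟩)
      · obtain ⟨x, y, hxy, hk⟩ := (hbit _).1 ((hbit' _).2 ⟨b, a, h, hne.symm, rfl⟩)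
        refine ⟨x, y, hxy, hk.trans ?_⟩
        -- The numbering of pairs is symmetric, so an edge listed in the opposite direction gives
        -- the same bit.
        have hval : (σ a : ℕ) ≠ σ b := Fin.val_ne_of_ne (hσ.ne hne)
        simp only [pairIndex, Bool.cond_eq_ite, Nat.blt_eq]
        split_ifs <;> omega
    rcases hinj _ _ _ _ hxy.ne (hσ.ne hne) hk with ⟨h₁, h₂⟩ | ⟨h₁, h₂⟩ <;> rw [← h₁, ← h₂]
    exacts [hxy, hxy.symm]

/-- The number of walks of length two. -/
noncomputable def pathCount {V : Type*} (G : SimpleGraph V) : ℕ :=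
  Nat.card {t : V × V × V // G.Adj t.1 t.2.1 ∧ G.Adj t.2.1 t.2.2}

/-- The number of closed walks of length three. -/
noncomputable def triangleCount {V : Type*} (G : SimpleGraph V) : ℕ :=
  Nat.card {t : V × V × V // G.Adj t.1 t.2.1 ∧ G.Adj t.2.1 t.2.2 ∧ G.Adj t.2.2 t.1}

theorem pathCount_congr {V W : Type*} {G : SimpleGraph V} {H : SimpleGraph W} (φ : G ≃g H) :
    pathCount G = pathCount H :=
  Nat.card_congr <| (φ.toEquiv.prodCongr (φ.toEquiv.prodCongr φ.toEquiv)).subtypeEquiv fun _ =>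
    and_congr φ.map_adj_iff.symm φ.map_adj_iff.symm

theorem triangleCount_congr {V W : Type*} {G : SimpleGraph V} {H : SimpleGraph W} (φ : G ≃g H) :
    triangleCount G = triangleCount H :=
  Nat.card_congr <| (φ.toEquiv.prodCongr (φ.toEquiv.prodCongr φ.toEquiv)).subtypeEquiv fun _ =>
    and_congr φ.map_adj_iff.symm (and_congr φ.map_adj_iff.symm φ.map_adj_iff.symm)

instance (j : Fin 23) : DecidableRel (graph j).Adj := fun _ _ =>
  decidable_of_iff _ listGraph_adj.symm

theorem pathCount_graph (j : Fin 23) : pathCount (graph j) =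
    ![2, 0, 2, 6, 12, 6, 10, 16, 12, 12, 18, 26, 36, 30, 44, 20, 30, 42, 40, 54, 52, 66, 80] j := by
  rw [pathCount, Nat.card_eq_fintype_card]
  revert j
  decide +kernel

theorem triangleCount_graph (j : Fin 23) : triangleCount (graph j) =
    ![0, 0, 0, 0, 6, 0, 0, 0, 6, 0, 6, 12, 24, 0, 18, 0, 6, 18, 12, 30, 24, 42, 60] j := by
  rw [triangleCount, Nat.card_eq_fintype_card]
  revert j
  decide +kernel

/-- The order, the number of walks of length two and the number of closed walks of length three
separate all 23 graphs. -/
theorem graph_iso_injective (i j : Fin 23) (h : Nonempty (graph i ≃g graph j)) : i = j := by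
  obtain ⟨φ⟩ := h
  have h₁ : graphOrder i = graphOrder j := by
    simpa using Fintype.card_congr φ.toEquiv
  have h₂ := pathCount_congr φ
  have h₃ := triangleCount_congr φ
  rw [pathCount_graph, pathCount_graph] at h₂
  rw [triangleCount_graph, triangleCount_graph] at h₃
  clear φ
  revert i j
  decide +kernel

theorem exists_graph_iso_or_acyclic {n : ℕ} (hn : n ≤ 5) (h0 : n ≠ 0) (H : SimpleGraph (Fin n)) :
    (∃ j, Nonempty (H ≃g graph j)) ∨ essentialBetti H 3 = 0 := by
  obtain ⟨E, hE, ⟨φ⟩⟩ := exists_iso_listGraph hn h0 H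
  rcases List.mem_append.1 hE with hE | hE
  · left
    obtain ⟨j, hj, rfl⟩ := List.mem_map.1 hE
    obtain rfl : graphOrder j = n := Nat.eq_of_beq_eq_true (List.mem_filter.1 hj).2
    exact ⟨j, ⟨φ⟩⟩
  · right
    rw [essentialBetti_congr φ]
    exact essentialBetti_listGraph (hn.trans (by norm_num)) h0 E 0
      (computeBetti_acyclicGraphs n hn E hE)

end Classification

/-! ## Graphs with many vertices -/

section ManyVertices

open Module

theorem essentialBetti_le_finrank_cocycles {V : Type*} [LinearOrder V] [Finite V]
    (G : SimpleGraph V) (k : ℕ) :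
    essentialBetti G k ≤ finrank ℝ (cocycles G (subcomplex G Set.univ) k) := by
  have h : essentialBetti G k + _ = _ :=
    finrank_cohomology G _ (differential_mem_subcomplex G Set.univ) k
  omega

/-- Three variables covering six vertices are disjoint edges, and `K_6` has 15 perfect matchings. A
term of the differential of a matching has one edge replaced by its endpoints and so determines the
matching; accordingly the rank is full. -/
theorem finrank_cocycles_top_six :
    finrank ℝ (cocycles (⊤ : SimpleGraph (Fin 6)) (subcomplex ⊤ Set.univ) 3) = 0 := by
  have hadj (i j : Fin 6) (hij : i < j) :
      (⊤ : SimpleGraph (Fin 6)).Adj i j ↔ ((i : ℕ), (j : ℕ)) ∈ pairs 6 :=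
    ⟨fun _ => mem_pairs.2 ⟨hij, j.2⟩, fun _ => hij.ne⟩
  have h₁ : essRank 6 (pairs 6) 3 = some 15 := by decide +kernel
  have h₂ : (essMonos 6 (pairs 6) 3).length = 15 := by decide +kernel
  have h := finrank_cocycles_add (subcomplex (⊤ : SimpleGraph (Fin 6)) Set.univ) 3
  rw [finrank_map_differential le_rfl (by norm_num) (List.Sublist.refl _) hadj 3 15 h₁,
    finrank_subcomplex_univ le_rfl (by norm_num) (List.Sublist.refl _) hadj, h₂] at h
  omega

theorem essentialBetti_fin_six (H : SimpleGraph (Fin 6)) : essentialBetti H 3 = 0 := by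
  let φ : H →g (⊤ : SimpleGraph (Fin 6)) := ⟨id, fun h => h.ne⟩
  have hφ : Function.Injective φ := Function.injective_id
  -- Coboundaries can be ignored: already the space of cocycles is zero, since it embeds in that of
  -- `K_6`.
  refine Nat.le_zero.1 ((essentialBetti_le_finrank_cocycles H 3).trans ?_)
  rw [← finrank_cocycles_top_six, (Submodule.equivMapOfInjective (cochainMap φ hφ).toLinearMap
    (cochainMap_injective φ hφ) (cocycles H (subcomplex H Set.univ) 3)).finrank_eq]
  refine Submodule.finrank_mono ?_
  rintro _ ⟨a, ⟨ha, ha'⟩, rfl⟩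
  refine ⟨?_, ?_⟩
  · have h := map_subcomplex_le φ hφ 3 ⟨a, ha, rfl⟩
    rwa [show Set.range φ = Set.univ from Set.range_id] at h
  · exact (differential_cochainMap φ hφ a).trans
      ((congrArg (cochainMap φ hφ) ha').trans (map_zero _))

theorem essentialBetti_eq_zero_of_subcomplex {V : Type*} [LinearOrder V] [Finite V]
    (G : SimpleGraph V) (k : ℕ) (h : subcomplex G Set.univ k = ⊥) : essentialBetti G k = 0 := by
  refine Nat.le_zero.1 ((essentialBetti_le_finrank_cocycles G k).trans ?_)
  rw [cocycles, h, bot_inf_eq, finrank_bot]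

/-- Each of the `k` factors covers at most two vertices. The empty vertex set is the case excluded
by convention. -/
theorem subcomplex_univ_eq_bot {V : Type*} [LinearOrder V] [Finite V] (G : SimpleGraph V) (k : ℕ)
    (h : Nat.card V = 0 ∨ 2 * k < Nat.card V) : subcomplex G Set.univ k = ⊥ := by
  classical
  have := Fintype.ofFinite V
  rw [subcomplex, Submodule.span_eq_bot]
  rintro _ ⟨⟨v, -⟩, p, q, hk, hpq, -⟩
  exfalso
  have hsub : (Finset.univ : Finset V) ⊆ (p ++ q.map Edge.src ++ q.map Edge.tgt).toFinset := by
    intro v _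
    have hv : v ∈ Set.univ := trivial
    rw [hpq] at hv
    simp only [List.mem_toFinset, List.mem_append, List.mem_map]
    rcases hv with hv | ⟨e, he, rfl | rfl⟩
    exacts [Or.inl (Or.inl hv), Or.inl (Or.inr ⟨e, he, rfl⟩), Or.inr ⟨e, he, rfl⟩]
  have hle := (Finset.card_le_card hsub).trans (List.toFinset_card_le _)
  simp only [List.length_append, List.length_map, Finset.card_univ, ← Nat.card_eq_fintype_card]
    at hle
  have := Nat.card_pos_iff.2 ⟨⟨v⟩, ‹Finite V›⟩
  omega

theorem exists_graph_iso_or_essentialBetti_eq_zero {V : Type*} [LinearOrder V] [Finite V]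
    (H : SimpleGraph V) : (∃ j, Nonempty (H ≃g graph j)) ∨ essentialBetti H 3 = 0 := by
  by_cases h : Nat.card V = 0 ∨ 2 * 3 < Nat.card V
  · exact Or.inr (essentialBetti_eq_zero_of_subcomplex H 3 (subcomplex_univ_eq_bot H 3 h))
  push Not at h
  have φ := SimpleGraph.Iso.map (Finite.equivFin V) H
  rw [essentialBetti_congr φ]
  rcases Nat.lt_or_eq_of_le h.2 with hlt | heq
  · refine (exists_graph_iso_or_acyclic (Nat.le_of_lt_succ hlt) h.1 _).imp_left ?_
    rintro ⟨j, ⟨ψ⟩⟩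
    exact ⟨j, ⟨φ.trans ψ⟩⟩
  · right
    clear φ
    generalize SimpleGraph.map (Finite.equivFin V).toEmbedding H = K
    revert K
    rw [heq]
    exact essentialBetti_fin_six

theorem essentialBetti_of_iso {V : Type*} [LinearOrder V] [Finite V] {H : SimpleGraph V}
    {j : Fin 23} (h : Nonempty (H ≃g graph j)) : essentialBetti H 3 = weight j := by
  rw [essentialBetti_congr h.some, essentialBetti_graph]

theorem essentialBetti_ne_zero_iff {V : Type*} [LinearOrder V] [Finite V] (H : SimpleGraph V) :
    essentialBetti H 3 ≠ 0 ↔ ∃ j, Nonempty (H ≃g graph j) := by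
  constructor
  · exact (exists_graph_iso_or_essentialBetti_eq_zero H).resolve_right
  · rintro ⟨j, h⟩
    rw [essentialBetti_of_iso h]
    clear h
    revert j
    decide

/-- At most one indicator is nonzero because the listed graphs are pairwise non-isomorphic. Summing
this over all induced subgraphs and exchanging the sums produces the induced counts. -/
theorem essentialBetti_eq_sum {V : Type*} [LinearOrder V] [Finite V] (H : SimpleGraph V)
    [∀ j, Decidable (Nonempty (H ≃g graph j))] :
    essentialBetti H 3 = ∑ j, if Nonempty (H ≃g graph j) then essentialBetti (graph j) 3 else 0 := by
  by_cases h : ∃ j, Nonempty (H ≃g graph j)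
  · obtain ⟨j, hj⟩ := h
    rw [Finset.sum_eq_single j, if_pos hj, essentialBetti_congr hj.some]
    · intro i _ hij
      exact if_neg fun hi => hij (graph_iso_injective i j ⟨hi.some.symm.trans hj.some⟩)
    · exact fun h => absurd (Finset.mem_univ j) h
  · rw [Finset.sum_eq_zero fun j _ => if_neg fun hj => h ⟨j, hj⟩]
    exact (exists_graph_iso_or_essentialBetti_eq_zero H).resolve_left h

theorem betti_three {V : Type*} [LinearOrder V] [Finite V] (G : SimpleGraph V) :
    betti G 3 = ∑ j, essentialBetti (graph j) 3 * inducedCount G (graph j) := by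
  classical
  have := Fintype.ofFinite (Set V)
  rw [betti_eq_sum_induce 3 (by norm_num)]
  simp only [essentialBetti_eq_sum (G.induce _)]
  rw [Finset.sum_comm]
  refine Finset.sum_congr rfl fun j _ => ?_
  rw [inducedCount, Nat.card_eq_fintype_card, Fintype.card_subtype, Finset.sum_ite,
    Finset.sum_const_zero, add_zero, Finset.sum_const, smul_eq_mul, mul_comm]

end ManyVertices

end DaniMainkar

theorem mainTheorem3 :
    -- the formula for the third cohomology of an arbitrary finite simple graph
    (∀ (V : Type*) [LinearOrder V] [Finite V] (G : SimpleGraph V),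
      DaniMainkar.betti G 3 =
        ∑ j : Fin 23, DaniMainkar.essentialBetti (DaniMainkar.graph j) 3 *
          DaniMainkar.inducedCount G (DaniMainkar.graph j)) ∧
    -- the weights
    (∀ j : Fin 23, DaniMainkar.essentialBetti (DaniMainkar.graph j) 3 = DaniMainkar.weight j) ∧
    -- the graphs in the list are pairwise non-isomorphic
    (∀ i j : Fin 23, Nonempty (DaniMainkar.graph i ≃g DaniMainkar.graph j) → i = j) ∧
    -- they are exactly the graphs with non-zero third essential cohomology
    (∀ (V : Type*) [LinearOrder V] [Finite V] (H : SimpleGraph V),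
      DaniMainkar.essentialBetti H 3 ≠ 0 ↔
        ∃ j : Fin 23, Nonempty (H ≃g DaniMainkar.graph j)) :=
  ⟨fun _ _ _ => DaniMainkar.betti_three, DaniMainkar.essentialBetti_graph,
    DaniMainkar.graph_iso_injective, fun _ _ _ => DaniMainkar.essentialBetti_ne_zero_iff⟩
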